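/- **Setting.** Let $L$ be a first-order language with equality, with coded symbols, containing symbols $0,1,2,\le,\mathrm{Max}$ and a standard model on $\mathbb N$ in which these symbols have their usual meaning. Formulas are built with Boolean connectives, bounded quantifiers $\forall v\le T$, $\exists v\le T$ ($T$ a term) and unbounded quantifiers; they have the usual Gödel numbers $\ulcorner\cdot\urcorner$ (codes of symbol strings). A *generic configuration* $\xi=(L,\Delta_0^\xi,B^\xi,d,g)$ over $L$ consists of the following. * Closed terms $T_k$ of value $k$, computable from $k\in\mathbb N$, and an r.e. class $\Delta_0^\xi$ of formulas all of whose quantifiers are bounded. The class is closed under Boolean connectives, renaming of variables and quantification bounded by a variable, it contains the equalities between variables, between a variable and some $T_k$, and between $T_j$ and $T_k$, and it contains formulas defining the graphs of addition and multiplication in $\mathbb N$. A $\Pi_0^\xi$ or $\Sigma_0^\xi$ formula is a $\Delta_0^\xi$ formula; a $\Pi_{n+1}^\xi$ (resp. $\Sigma_{n+1}^\xi$) formula is a possibly empty block of unbounded universal (resp. existential) quantifiers followed by a $\Sigma_n^\xi$ (resp. $\Pi_n^\xi$) formula. The negation of a $\Pi_n^\xi$ sentence is written as a $\Sigma_n^\xi$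 sentence by dualizing the unbounded quantifiers and negating the matrix. * An r.e. set $B^\xi$ of sentences, all true in $\mathbb N$, from which $d$ proves every true $\Sigma_1^\xi$ sentence. * A deduction method $d$ (each proof derives a sentence from the finite list of axioms it cites) and an injective Gödel numbering $g$ of its proofs such that the relation "$p$ codes a proof of $t$ citing the axioms $A$" is r.e. For every $\alpha\supseteq B^\xi$, $d$ proves from $\alpha$ every logical consequence of $\alpha$, and if it proves $X$, $Y$ and $(X\wedge Y)\to Z$, it proves $Z$. **Stability.** A sentence is $\mathrm{Good}(N)$ if it becomes true in $\mathbb N$ when its unbounded quantifiers are restricted to numbers $<2^N$ (no restriction if $N=\infty$). For a set $\theta$ of $\Pi_1^\xi$ sentences, $\sharp(\theta)$ is the largest integer $J\ge 0$ for which all members of $\theta$ are $\mathrm{Good}(J)$ ($\infty$ if all $J$ qualify, $-\infty$ if none does). Let $\theta$ range over all r.e. sets of $\Pi_1^\xi$ sentences, and let $p$ range over the codes of $d$-proofs from $\theta\cup B^\xi$ with $\log_2 p\le\sharp(\theta)+1$. The configuration $\xi$ is *A-stable* if every $\Pi_1^\xi$ sentence proved by such a $p$ is $\mathrm{Good}(\tfrac12\sharp(\theta))$;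 *E-stable* if every $\Sigma_1^\xi$ sentence proved by such a $p$ is $\mathrm{Good}(\tfrac12\lfloor\log_2 p\rfloor-1)$; *0-stable* if every $\Delta_0^\xi$ sentence proved by such a $p$ is true in $\mathbb N$; *EA-stable* if it is both E-stable and A-stable. **The systems.** Let $\iota:L\to L'$ be an effective extension of languages, $\mathcal B$ an r.e. set of $L'$-sentences, and $D$ any deduction method for $L'$ with an effective Gödel numbering of its proofs; no other property of $D$ is assumed. Let $P(t,q,w)$ be a $\Delta_0^\xi$ formula with $\Delta_0^\xi$ numeral instances $P(T_m,q,w)$ such that, for every $L$-sentence $\Psi$ and all $q$, $\exists w\,P(\ulcorner\Psi\urcorner,q,w)$ holds in $\mathbb N$ iff $q$ codes a $D$-proof of $\Psi$ from $\mathcal B$. (The variable $w$ is a verification witness; it may be idle.) The *Group-2 schema* $\theta_P$ consists of the sentences $\forall q\,\forall w\,\forall \vec v\,(P(T_{\ulcorner\Psi\urcorner},q,w)\to\varphi(\vec v))$ for all $\Pi_1^\xi$ sentences $\Psi=\forall\vec v\,\varphi(\vec v)$ with $\varphi\in\Delta_0^\xi$. For $\beta\supseteq B^\xi$, a sentence $\mathrm{SelfCons}^k(\beta,d)$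 is any sentence $\Gamma(T_n)$, where $$\Gamma(z)=\forall x\,y\,p\,q\,u\,v\,w\;\neg\{N(x,y,u)\wedge S(z,x,p,v)\wedge S(z,y,q,w)\},\qquad n=\ulcorner\Gamma\urcorner .$$ Here $N$ and $S$ are $\Delta_0^\xi$ formulas, and the numeral instances $S(T_m,t,p,w)$ are also $\Delta_0^\xi$. In $\mathbb N$, $\exists u\,N(x,y,u)$ holds iff $x$ codes a $\Pi_k^\xi$ sentence and $y$ its $\Sigma_k^\xi$ negation. For every formula $\Gamma'(z)$ with one free variable, $\exists w\,S(\ulcorner\Gamma'\urcorner,t,p,w)$ holds iff $p$ codes a $d$-proof of the sentence coded by $t$ from $\beta\cup\{\Gamma'(T_{\ulcorner\Gamma'\urcorner})\}$. Thus $\mathrm{SelfCons}^k(\beta,d)$ asserts the Level$(k^\xi)$ consistency of $\beta\cup\{\mathrm{SelfCons}^k(\beta,d)\}$, that is, that $d$ does not prove from it both a $\Pi_k^\xi$ sentence and its $\Sigma_k^\xi$ negation. **Theorem.** Suppose every $\Pi_1^\xi$ sentence provable in $(\mathcal B,D)$ is true in $\mathbb N$. Let $k=1$ if $\xi$ is EA-stable,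 or $k=0$ if $\xi$ is A-stable, E-stable or 0-stable. Then formulas $P$ as above exist; for each of them there are sentences $\Phi=\mathrm{SelfCons}^k(\theta_P\cup B^\xi,d)$; and for every choice of $P$ and $\Phi$ the sentence $\Phi$ is $\Pi_1^\xi$ and the system $$\alpha=\theta_P\cup B^\xi\cup\{\Phi\}$$ is r.e., self-justifying at level $k$ (it proves the sentence $\Phi$, which asserts its own Level$(k^\xi)$ consistency, and it is in fact both Level$(k^\xi)$ consistent and consistent), and proves every $\Pi_1^\xi$ theorem of $(\mathcal B,D)$. -/

import Mathlib

open FirstOrder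

/-! ## Syntax: first-order formulas with bounded quantifiers as primitives -/

/-- Formulas of the language `L` in the free variables `0, …, n-1`. A quantifier binds the
variable `n` of its body. The bounded quantifiers `∀ v ≤ T` and `∃ v ≤ T` are syntactically
distinct from the unbounded ones; their bound `T` is a term not containing `v`. -/
inductive Fml (L : FirstOrder.Language.{0, 0}) : ℕ → Type
  | eq {n : ℕ} (s t : L.Term (Fin n)) : Fml L n
  | rel {n k : ℕ} (R : L.Relations k) (ts : Fin k → L.Term (Fin n)) : Fml L n
  | neg {n : ℕ} (φ : Fml L n) : Fml L n
  | and {n : ℕ} (φ ψ : Fml L n) : Fml L n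
  | or {n : ℕ} (φ ψ : Fml L n) : Fml L n
  | imp {n : ℕ} (φ ψ : Fml L n) : Fml L n
  | ball {n : ℕ} (T : L.Term (Fin n)) (φ : Fml L (n + 1)) : Fml L n
  | bex {n : ℕ} (T : L.Term (Fin n)) (φ : Fml L (n + 1)) : Fml L n
  | all {n : ℕ} (φ : Fml L (n + 1)) : Fml L n
  | ex {n : ℕ} (φ : Fml L (n + 1)) : Fml L n

/-- Sentences are formulas without free variables. -/
abbrev Sent (L : FirstOrder.Language.{0, 0}) : Type := Fml L 0

namespace Fml

variable {L : FirstOrder.Language.{0, 0}}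

/-- All quantifiers of the formula are bounded. -/
def FullyBounded : {n : ℕ} → Fml L n → Prop
  | _, eq _ _ => True
  | _, rel _ _ => True
  | _, neg φ => φ.FullyBounded
  | _, and φ ψ => φ.FullyBounded ∧ ψ.FullyBounded
  | _, or φ ψ => φ.FullyBounded ∧ ψ.FullyBounded
  | _, imp φ ψ => φ.FullyBounded ∧ ψ.FullyBounded
  | _, ball _ φ => φ.FullyBounded
  | _, bex _ φ => φ.FullyBounded
  | _, all _ => False
  | _, ex _ => False

/-- Simultaneous capture-free substitution of terms for the free variables. -/
def subst : {m n : ℕ} → Fml L m → (Fin m → L.Term (Fin n)) → Fml L n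
  | _, _, eq s t, σ => eq (s.subst σ) (t.subst σ)
  | _, _, rel R ts, σ => rel R fun i => (ts i).subst σ
  | _, _, neg φ, σ => neg (φ.subst σ)
  | _, _, and φ ψ, σ => and (φ.subst σ) (ψ.subst σ)
  | _, _, or φ ψ, σ => or (φ.subst σ) (ψ.subst σ)
  | _, _, imp φ ψ, σ => imp (φ.subst σ) (ψ.subst σ)
  | _, n, ball T φ, σ => ball (T.subst σ)
      (φ.subst (Fin.snoc (fun i => (σ i).relabel Fin.castSucc)
        (FirstOrder.Language.Term.var (Fin.last n))))
  | _, n, bex T φ, σ => bex (T.subst σ)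
      (φ.subst (Fin.snoc (fun i => (σ i).relabel Fin.castSucc)
        (FirstOrder.Language.Term.var (Fin.last n))))
  | _, n, all φ, σ => all
      (φ.subst (Fin.snoc (fun i => (σ i).relabel Fin.castSucc)
        (FirstOrder.Language.Term.var (Fin.last n))))
  | _, n, ex φ, σ => ex
      (φ.subst (Fin.snoc (fun i => (σ i).relabel Fin.castSucc)
        (FirstOrder.Language.Term.var (Fin.last n))))

/-- Renaming of the free variables. -/
def rename {m n : ℕ} (φ : Fml L m) (f : Fin m → Fin n) : Fml L n :=
  φ.subst fun i => FirstOrder.Language.Term.var (f i)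

/-- `∀ v₀ ∀ v₁ … ∀ vₖ₋₁ φ`. -/
def allClosure : {k : ℕ} → Fml L k → Sent L
  | 0, φ => φ
  | _ + 1, φ => allClosure (all φ)

/-- The negation of a prenex formula, written in prenex form: the leading unbounded quantifiers
are dualized and the matrix is negated. -/
def prenexNeg : {n : ℕ} → Fml L n → Fml L n
  | _, all φ => ex φ.prenexNeg
  | _, ex φ => all φ.prenexNeg
  | _, φ => neg φ

/-- Translation along a map of languages. -/
def onLang {L' : FirstOrder.Language.{0, 0}} (ι : L →ᴸ L') : {n : ℕ} → Fml L n → Fml L' n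
  | _, eq s t => eq (ι.onTerm s) (ι.onTerm t)
  | _, rel R ts => rel (ι.onRelation R) fun i => ι.onTerm (ts i)
  | _, neg φ => neg (φ.onLang ι)
  | _, and φ ψ => and (φ.onLang ι) (ψ.onLang ι)
  | _, or φ ψ => or (φ.onLang ι) (ψ.onLang ι)
  | _, imp φ ψ => imp (φ.onLang ι) (ψ.onLang ι)
  | _, ball T φ => ball (ι.onTerm T) (φ.onLang ι)
  | _, bex T φ => bex (ι.onTerm T) (φ.onLang ι)
  | _, all φ => all (φ.onLang ι)
  | _, ex φ => ex (φ.onLang ι)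

/-! ### Semantics -/

/-- Truth in a structure when the unbounded quantifiers range over the subset `R` only.
Bounded quantifiers are not affected by `R`. -/
def RealizeOn [L.IsOrdered] {M : Type} [L.Structure M] (R : Set M) :
    {n : ℕ} → Fml L n → (Fin n → M) → Prop
  | _, eq s t, v => s.realize v = t.realize v
  | _, rel S ts, v => FirstOrder.Language.Structure.RelMap S fun i => (ts i).realize v
  | _, neg φ, v => ¬ φ.RealizeOn R v
  | _, and φ ψ, v => φ.RealizeOn R v ∧ ψ.RealizeOn R v
  | _, or φ ψ, v => φ.RealizeOn R v ∨ ψ.RealizeOn R v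
  | _, imp φ ψ, v => φ.RealizeOn R v → ψ.RealizeOn R v
  | _, ball T φ, v => ∀ a : M,
      FirstOrder.Language.Structure.RelMap
        (FirstOrder.Language.leSymb : L.Relations 2) ![a, T.realize v] →
        φ.RealizeOn R (Fin.snoc v a)
  | _, bex T φ, v => ∃ a : M,
      FirstOrder.Language.Structure.RelMap
        (FirstOrder.Language.leSymb : L.Relations 2) ![a, T.realize v] ∧
        φ.RealizeOn R (Fin.snoc v a)
  | _, all φ, v => ∀ a ∈ R, φ.RealizeOn R (Fin.snoc v a)
  | _, ex φ, v => ∃ a ∈ R, φ.RealizeOn R (Fin.snoc v a)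

/-- Tarskian truth in a structure. -/
def Realize [L.IsOrdered] {M : Type} [L.Structure M] {n : ℕ} (φ : Fml L n) (v : Fin n → M) :
    Prop :=
  φ.RealizeOn Set.univ v

/-- Truth of a sentence in the standard model of the natural numbers. -/
def TrueInNat [L.IsOrdered] [L.Structure ℕ] (φ : Sent L) : Prop :=
  φ.Realize (Fin.elim0 : Fin 0 → ℕ)

/-- Semantic consequence in first-order logic with equality. -/
def Entails [L.IsOrdered] (α : Set (Sent L)) (t : Sent L) : Prop :=
  ∀ (M : Type) [L.Structure M] [Nonempty M],
    (∀ a ∈ α, a.Realize (Fin.elim0 : Fin 0 → M)) → t.Realize (Fin.elim0 : Fin 0 → M)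

/-- The natural numbers below `2 ^ N`; all of them for `N = ∞`. -/
def numbersBelow (N : EReal) : Set ℕ :=
  {v | v = 0 ∨ ((Real.logb 2 (v : ℝ) : ℝ) : EReal) < N}

/-- `Good(N)`: the sentence becomes true in the standard model when its unbounded quantifiers
are restricted to the numbers `< 2 ^ N`. -/
def Good [L.IsOrdered] [L.Structure ℕ] (N : EReal) (φ : Sent L) : Prop :=
  φ.RealizeOn (numbersBelow N) (Fin.elim0 : Fin 0 → ℕ)

/-- `♯(θ)`: the largest integer `J` such that all members of `θ` are `Good(J)`
(`∞` if there is no largest one, `-∞` if there is none). -/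
noncomputable def sharp [L.IsOrdered] [L.Structure ℕ] (θ : Set (Sent L)) : EReal :=
  sSup {x : EReal | ∃ J : ℕ, x = ((J : ℝ) : EReal) ∧ ∀ φ ∈ θ, Good x φ}

/-! ### Gödel numbers of formulas -/

section Code

variable [∀ k, Encodable (L.Functions k)] [∀ k, Encodable (L.Relations k)]

/-- A term as a string of symbols in prefix notation. -/
def termTokens {n : ℕ} : L.Term (Fin n) → List ℕ
  | FirstOrder.Language.Term.var i => [Nat.pair 0 i]
  | FirstOrder.Language.Term.func (l := k) f ts =>
      Nat.pair 1 (Nat.pair k (Encodable.encode f)) ::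
        (List.ofFn fun i => termTokens (ts i)).flatten

/-- A formula as a string of symbols in prefix notation. -/
def tokens : {n : ℕ} → Fml L n → List ℕ
  | _, eq s t => Nat.pair 2 0 :: (termTokens s ++ termTokens t)
  | _, rel (k := k) R ts =>
      Nat.pair 3 (Nat.pair k (Encodable.encode R)) ::
        (List.ofFn fun i => termTokens (ts i)).flatten
  | _, neg φ => Nat.pair 2 1 :: φ.tokens
  | _, and φ ψ => Nat.pair 2 2 :: (φ.tokens ++ ψ.tokens)
  | _, or φ ψ => Nat.pair 2 3 :: (φ.tokens ++ ψ.tokens)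
  | _, imp φ ψ => Nat.pair 2 4 :: (φ.tokens ++ ψ.tokens)
  | _, ball T φ => Nat.pair 2 5 :: (termTokens T ++ φ.tokens)
  | _, bex T φ => Nat.pair 2 6 :: (termTokens T ++ φ.tokens)
  | _, all φ => Nat.pair 2 7 :: φ.tokens
  | _, ex φ => Nat.pair 2 8 :: φ.tokens

/-- The Gödel number of a formula. -/
def code {n : ℕ} (φ : Fml L n) : ℕ := Encodable.encode φ.tokens

/-- A recursively enumerable set of sentences. -/
def IsRE (α : Set (Sent L)) : Prop :=
  REPred fun c : ℕ => ∃ φ ∈ α, φ.code = c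

end Code

end Fml

/-! ## Deduction methods -/

/-- A deduction method for the sentences of `L`: `Derives π A t` says that `π` is a proof of the
theorem `t` in which exactly the axioms in the list `A` are cited. -/
structure DeductionMethod (L : FirstOrder.Language.{0, 0}) where
  Proof : Type
  Derives : Proof → List (Sent L) → Sent L → Prop

/-- An effective Gödel numbering of the proofs of a deduction method. -/
structure ProofNumbering {L : FirstOrder.Language.{0, 0}}
    [∀ k, Encodable (L.Functions k)] [∀ k, Encodable (L.Relations k)]
    (d : DeductionMethod L) where
  num : d.Proof → ℕ
  injective : Function.Injective num
  effective : REPred fun x : ℕ × ℕ × List ℕ =>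
    ∃ π A t, d.Derives π A t ∧ num π = x.1 ∧ t.code = x.2.1 ∧ A.map Fml.code = x.2.2

namespace DeductionMethod

variable {L : FirstOrder.Language.{0, 0}}

/-- `π` is a proof of `t` from the axiom system `α`. -/
def ProofFrom (d : DeductionMethod L) (α : Set (Sent L)) (t : Sent L) (π : d.Proof) : Prop :=
  ∃ A : List (Sent L), d.Derives π A t ∧ ∀ a ∈ A, a ∈ α

/-- `t` is a theorem of the axiom system `α`. -/
def Proves (d : DeductionMethod L) (α : Set (Sent L)) (t : Sent L) : Prop :=
  ∃ π, d.ProofFrom α t π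

/-- No sentence is provable together with its negation. -/
def Consistent (d : DeductionMethod L) (α : Set (Sent L)) : Prop :=
  ¬ ∃ t : Sent L, d.Proves α t ∧ d.Proves α (Fml.neg t)

/-- The number `p` codes a proof from `α` of the sentence `t`. -/
def Prf [∀ k, Encodable (L.Functions k)] [∀ k, Encodable (L.Relations k)]
    (d : DeductionMethod L) (g : ProofNumbering d) (α : Set (Sent L)) (t : Sent L) (p : ℕ) :
    Prop :=
  ∃ π, d.ProofFrom α t π ∧ g.num π = p

end DeductionMethod

/-! ## The hierarchy over a class `Δ₀` -/

/-- `Prenex Δ true k` are the `Π_k` formulas and `Prenex Δ false k` the `Σ_k` formulas built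
over the class `Δ`: a `Π_{k+1}` formula is a (possibly empty) block of unbounded universal
quantifiers followed by a `Σ_k` formula, and dually. -/
inductive Prenex {L : FirstOrder.Language.{0, 0}} (Δ : ∀ n, Set (Fml L n)) :
    Bool → ℕ → ∀ {n : ℕ}, Fml L n → Prop
  | zero {b : Bool} {n : ℕ} {φ : Fml L n} : φ ∈ Δ n → Prenex Δ b 0 φ
  | step {b : Bool} {k n : ℕ} {φ : Fml L n} : Prenex Δ (!b) k φ → Prenex Δ b (k + 1) φ
  | all {k n : ℕ} {φ : Fml L (n + 1)} :
      Prenex Δ true (k + 1) φ → Prenex Δ true (k + 1) (Fml.all φ)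
  | ex {k n : ℕ} {φ : Fml L (n + 1)} :
      Prenex Δ false (k + 1) φ → Prenex Δ false (k + 1) (Fml.ex φ)

/-! ## Generic configurations -/

/-- A generic configuration `(L, Δ₀, B, d, g)` over a language `L` with a standard model `ℕ`. -/
structure GenericConfiguration (L : FirstOrder.Language.{0, 0}) [L.IsOrdered] [L.Structure ℕ]
    [L.OrderedStructure ℕ]
    [∀ k, Encodable (L.Functions k)] [∀ k, Encodable (L.Relations k)] where
  /-- The symbols `0`, `1`, `2` and `Maximum`, with their standard meaning. -/
  zeroSym : L.Functions 0
  oneSym : L.Functions 0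
  twoSym : L.Functions 0
  maxSym : L.Functions 2
  zero_std : FirstOrder.Language.Structure.funMap zeroSym ![] = (0 : ℕ)
  one_std : FirstOrder.Language.Structure.funMap oneSym ![] = (1 : ℕ)
  two_std : FirstOrder.Language.Structure.funMap twoSym ![] = (2 : ℕ)
  max_std : ∀ a b : ℕ, FirstOrder.Language.Structure.funMap maxSym ![a, b] = max a b
  /-- The closed term `T_k` with the value `k`, computable from `k`. -/
  numeral : ℕ → L.Term (Fin 0)
  numeral_std : ∀ k : ℕ, (numeral k).realize (Fin.elim0 : Fin 0 → ℕ) = k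
  numeral_computable : Computable fun k => Fml.termTokens (numeral k)
  /-- The class `Δ₀` of fully bounded formulas, sorted by the number of free variables. -/
  Delta : ∀ n, Set (Fml L n)
  fullyBounded : ∀ {n} {φ : Fml L n}, φ ∈ Delta n → φ.FullyBounded
  delta_re : REPred fun x : ℕ × ℕ => ∃ φ ∈ Delta x.1, φ.code = x.2
  neg_mem : ∀ {n} {φ : Fml L n}, φ ∈ Delta n → Fml.neg φ ∈ Delta n
  and_mem : ∀ {n} {φ ψ : Fml L n}, φ ∈ Delta n → ψ ∈ Delta n → Fml.and φ ψ ∈ Delta n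
  or_mem : ∀ {n} {φ ψ : Fml L n}, φ ∈ Delta n → ψ ∈ Delta n → Fml.or φ ψ ∈ Delta n
  imp_mem : ∀ {n} {φ ψ : Fml L n}, φ ∈ Delta n → ψ ∈ Delta n → Fml.imp φ ψ ∈ Delta n
  rename_mem : ∀ {m n} {φ : Fml L m} (f : Fin m → Fin n), φ ∈ Delta m → φ.rename f ∈ Delta n
  ball_mem : ∀ {n} (i : Fin n) {φ : Fml L (n + 1)}, φ ∈ Delta (n + 1) →
    Fml.ball (FirstOrder.Language.Term.var i) φ ∈ Delta n
  bex_mem : ∀ {n} (i : Fin n) {φ : Fml L (n + 1)}, φ ∈ Delta (n + 1) →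
    Fml.bex (FirstOrder.Language.Term.var i) φ ∈ Delta n
  var_eq_var_mem : ∀ {n} (i j : Fin n),
    Fml.eq (FirstOrder.Language.Term.var i) (FirstOrder.Language.Term.var j) ∈ Delta n
  var_eq_numeral_mem : ∀ {n} (i : Fin n) (k : ℕ),
    Fml.eq (FirstOrder.Language.Term.var i) ((numeral k).relabel Fin.elim0) ∈ Delta n
  numeral_eq_numeral_mem : ∀ j k : ℕ, Fml.eq (numeral j) (numeral k) ∈ Delta 0
  /-- The graphs of addition and multiplication are `Δ₀`. -/
  add_mem : ∃ φ ∈ Delta 3, ∀ x y z : ℕ, φ.Realize ![x, y, z] ↔ x + y = z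
  mult_mem : ∃ φ ∈ Delta 3, ∀ x y z : ℕ, φ.Realize ![x, y, z] ↔ x * y = z
  /-- The method of deduction `d` and the Gödel numbering `g` of its proofs. -/
  d : DeductionMethod L
  g : ProofNumbering d
  /-- The base axiom system. -/
  B : Set (Sent L)
  B_re : Fml.IsRE B
  B_true : ∀ a ∈ B, Fml.TrueInNat a
  sigma_complete : ∀ t : Sent L, Prenex Delta false 1 t → Fml.TrueInNat t → d.Proves B t
  /-- The deduction method finds every logical consequence of every extension of the base
  system, and its theorems are closed under the indirect implication rule. -/
  d_complete : ∀ α : Set (Sent L), B ⊆ α → ∀ t, Fml.Entails α t → d.Proves α t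
  d_indirect : ∀ α : Set (Sent L), B ⊆ α → ∀ X Y Z : Sent L,
    d.Proves α X → d.Proves α Y → d.Proves α (Fml.imp (Fml.and X Y) Z) → d.Proves α Z

namespace GenericConfiguration

variable {L : FirstOrder.Language.{0, 0}} [L.IsOrdered] [L.Structure ℕ] [L.OrderedStructure ℕ]
  [∀ k, Encodable (L.Functions k)] [∀ k, Encodable (L.Relations k)]

/-- `Π_k` sentences of the configuration. -/
def IsPi (ξ : GenericConfiguration L) (k : ℕ) (t : Sent L) : Prop := Prenex ξ.Delta true k t

/-- `Σ_k` sentences of the configuration. -/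
def IsSigma (ξ : GenericConfiguration L) (k : ℕ) (t : Sent L) : Prop := Prenex ξ.Delta false k t

/-- An R-View: an r.e. set of `Π₁` sentences, not necessarily true ones. -/
def IsRView (ξ : GenericConfiguration L) (θ : Set (Sent L)) : Prop :=
  Fml.IsRE θ ∧ ∀ a ∈ θ, ξ.IsPi 1 a

/-- `p` codes a proof of `t` from `θ ∪ B` with `Log(p) ≤ ♯(θ) + 1`. -/
def ShortProof (ξ : GenericConfiguration L) (θ : Set (Sent L)) (t : Sent L) (p : ℕ) : Prop :=
  ξ.d.Prf ξ.g (θ ∪ ξ.B) t p ∧ ((Real.logb 2 (p : ℝ) : ℝ) : EReal) ≤ Fml.sharp θ + 1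

def AStable (ξ : GenericConfiguration L) : Prop :=
  ∀ θ, ξ.IsRView θ → ∀ t p, ξ.IsPi 1 t → ξ.ShortProof θ t p → Fml.Good (Fml.sharp θ / 2) t

def EStable (ξ : GenericConfiguration L) : Prop :=
  ∀ θ, ξ.IsRView θ → ∀ t p, ξ.IsSigma 1 t → ξ.ShortProof θ t p →
    Fml.Good (((⌊Real.logb 2 (p : ℝ)⌋ : ℝ) / 2 - 1 : ℝ) : EReal) t

def EAStable (ξ : GenericConfiguration L) : Prop := ξ.EStable ∧ ξ.AStable

def ZeroStable (ξ : GenericConfiguration L) : Prop :=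
  ∀ θ, ξ.IsRView θ → ∀ t p, t ∈ ξ.Delta 0 → ξ.ShortProof θ t p → Fml.TrueInNat t

/-- Level(k) consistency of an axiom system. -/
def LevelConsistent (ξ : GenericConfiguration L) (k : ℕ) (α : Set (Sent L)) : Prop :=
  ¬ ∃ t : Sent L, ξ.IsPi k t ∧ ξ.d.Proves α t ∧ ξ.d.Proves α t.prenexNeg

/-! ### The self-referential consistency sentence -/

/-- The numeral `T_k` as a term in `n` variables. -/
def num (ξ : GenericConfiguration L) (n k : ℕ) : L.Term (Fin n) :=
  (ξ.numeral k).relabel Fin.elim0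

/-- `Γ(T_m)`, where `m` is the Gödel number of `Γ(v)`. -/
def selfApply (ξ : GenericConfiguration L) (Γ : Fml L 1) : Sent L :=
  Γ.subst ![ξ.numeral Γ.code]

/-- `N(x, y, w)` is a `Δ₀` formula expressing that `w` verifies that `x` codes a `Π_k` sentence
and `y` the `Σ_k` sentence that is its negation. (If this relation of `x` and `y` is itself
`Δ₀`, the witness `w` may be idle.) -/
def ExpressesNeg (ξ : GenericConfiguration L) (k : ℕ) (N : Fml L 3) : Prop :=
  N ∈ ξ.Delta 3 ∧
    ∀ x y : ℕ, (∃ w : ℕ, N.Realize ![x, y, w]) ↔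
      ∃ t : Sent L, ξ.IsPi k t ∧ t.code = x ∧ t.prenexNeg.code = y

/-- `S(g, t, p, w)` is a `Δ₀` formula, with `Δ₀` numeral instances `S(T_m, t, p, w)`, expressing
that `w` verifies that `p` codes a proof of the sentence coded by `t` from the axiom system `β`
together with the sentence `Γ(T_g)`, where `g` is the Gödel number of `Γ(v)`. -/
def ExpressesSubstPrf (ξ : GenericConfiguration L) (β : Set (Sent L)) (S : Fml L 4) : Prop :=
  S ∈ ξ.Delta 4 ∧
    (∀ m : ℕ, S.subst ![ξ.num 3 m, FirstOrder.Language.Term.var 0, FirstOrder.Language.Term.var 1,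
      FirstOrder.Language.Term.var 2] ∈ ξ.Delta 3) ∧
    ∀ (Γ : Fml L 1) (t p : ℕ), (∃ w : ℕ, S.Realize ![Γ.code, t, p, w]) ↔
      ∃ τ : Sent L, τ.code = t ∧ ξ.d.Prf ξ.g (β ∪ {ξ.selfApply Γ}) τ p

/-- The formula `Γ(g)`:
`∀ x y p q u v w ¬ (N(x, y, u) ∧ S(g, x, p, v) ∧ S(g, y, q, w))`. -/
def selfConsFml (N : Fml L 3) (S : Fml L 4) : Fml L 1 :=
  .all <| .all <| .all <| .all <| .all <| .all <| .all <| .neg <|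
    Fml.and (N.rename ![(1 : Fin 8), 2, 5])
      (Fml.and (S.rename ![(0 : Fin 8), 1, 3, 6]) (S.rename ![(0 : Fin 8), 2, 4, 7]))

/-- `Φ` is a sentence `SelfCons^k(β, d)`: it asserts the Level(k) consistency of the union of `β`
with `Φ` itself, through formulas that express negation and provability. -/
def IsSelfCons (ξ : GenericConfiguration L) (k : ℕ) (β : Set (Sent L)) (Φ : Sent L) : Prop :=
  ∃ (N : Fml L 3) (S : Fml L 4), ξ.ExpressesNeg k N ∧ ξ.ExpressesSubstPrf β S ∧
    Φ = ξ.selfApply (selfConsFml N S)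

/-- The axiom system `α` extends the base system and proves a sentence that asserts the Level(k)
consistency of `α` itself. -/
def RecognizesOwnConsistency (ξ : GenericConfiguration L) (k : ℕ) (α : Set (Sent L)) : Prop :=
  ∃ (β : Set (Sent L)) (Φ : Sent L), ξ.B ⊆ β ∧ α = β ∪ {Φ} ∧ ξ.IsSelfCons k β Φ ∧
    ξ.d.Proves α Φ

/-- `α` is self-justifying at level `k`: it recognizes its own Level(k) consistency and it is in
fact consistent. -/
def SelfJustifying (ξ : GenericConfiguration L) (k : ℕ) (α : Set (Sent L)) : Prop :=
  ξ.RecognizesOwnConsistency k α ∧ ξ.LevelConsistent k α ∧ ξ.d.Consistent α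

/-! ### The reflection schema for a second system -/

/-- `P(t, q, w)` is a `Δ₀` formula, with `Δ₀` numeral instances `P(T_m, q, w)`, expressing that
`w` verifies that `q` codes a `D`-proof from `𝓑` of the `L`-sentence coded by `t`. Here `𝓑` and
`D` belong to a language `L'` into which `L` is mapped by `ι`. -/
def ExpressesPrf (ξ : GenericConfiguration L) {L' : FirstOrder.Language.{0, 0}}
    [∀ k, Encodable (L'.Functions k)] [∀ k, Encodable (L'.Relations k)] (ι : L →ᴸ L')
    (𝓑 : Set (Sent L')) (D : DeductionMethod L') (G : ProofNumbering D) (P : Fml L 3) : Prop :=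
  P ∈ ξ.Delta 3 ∧
    (∀ m : ℕ, P.subst ![ξ.num 2 m, FirstOrder.Language.Term.var 0,
      FirstOrder.Language.Term.var 1] ∈ ξ.Delta 2) ∧
    ∀ (Ψ : Sent L) (q : ℕ), (∃ w : ℕ, P.Realize ![Ψ.code, q, w]) ↔
      D.Prf G 𝓑 (Ψ.onLang ι) q

/-- The reflection axiom `∀ q ∀ w (P(⌈Ψ⌉, q, w) → Ψ)` for `Ψ = ∀ v₀ … ∀ vₖ₋₁ φ`, written in
prenex form `∀ q ∀ w ∀ v₀ … ∀ vₖ₋₁ (P(⌈Ψ⌉, q, w) → φ)`. -/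
def reflectionAxiom (ξ : GenericConfiguration L) (P : Fml L 3) {k : ℕ} (φ : Fml L k) : Sent L :=
  Fml.allClosure (k := 2 + k)
    (Fml.imp ((P.subst ![ξ.num 2 (Fml.allClosure φ).code, FirstOrder.Language.Term.var 0,
        FirstOrder.Language.Term.var 1]).rename (Fin.castAdd k))
      (φ.rename (Fin.natAdd 2)))

/-- The Group-2 schema: the reflection axioms for all `Π₁` sentences. -/
def group2 (ξ : GenericConfiguration L) (P : Fml L 3) : Set (Sent L) :=
  {a | ∃ (k : ℕ) (φ : Fml L k), φ ∈ ξ.Delta k ∧ a = ξ.reflectionAxiom P φ}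

/-- The conclusion at level `k` for the pair `(𝓑, D)`: suitable provability formulas and
self-consistency sentences exist, and however they are chosen, the union of the Group-2 schema,
the base system and the self-consistency sentence is an r.e. self-justifying system that proves
every `Π₁` theorem of `(𝓑, D)`. -/
def HasReflectiveSystems (ξ : GenericConfiguration L) (k : ℕ) {L' : FirstOrder.Language.{0, 0}}
    [∀ k, Encodable (L'.Functions k)] [∀ k, Encodable (L'.Relations k)] (ι : L →ᴸ L')
    (𝓑 : Set (Sent L')) (D : DeductionMethod L') (G : ProofNumbering D) : Prop :=
  (∃ P : Fml L 3, ξ.ExpressesPrf ι 𝓑 D G P) ∧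
    ∀ P : Fml L 3, ξ.ExpressesPrf ι 𝓑 D G P →
      (∃ Φ : Sent L, ξ.IsSelfCons k (ξ.group2 P ∪ ξ.B) Φ) ∧
        ∀ Φ : Sent L, ξ.IsSelfCons k (ξ.group2 P ∪ ξ.B) Φ →
          Fml.IsRE (ξ.group2 P ∪ ξ.B ∪ {Φ}) ∧ ξ.IsPi 1 Φ ∧
            ξ.SelfJustifying k (ξ.group2 P ∪ ξ.B ∪ {Φ}) ∧
            ∀ Ψ : Sent L, ξ.IsPi 1 Ψ → D.Proves 𝓑 (Ψ.onLang ι) →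
              ξ.d.Proves (ξ.group2 P ∪ ξ.B ∪ {Φ}) Ψ

end GenericConfiguration

/-- `L'` is an effective extension of the language `L`. -/
def EffectiveExtension {L L' : FirstOrder.Language.{0, 0}}
    [∀ k, Encodable (L.Functions k)] [∀ k, Encodable (L.Relations k)]
    [∀ k, Encodable (L'.Functions k)] [∀ k, Encodable (L'.Relations k)] (ι : L →ᴸ L') : Prop :=
  ι.Injective ∧ ∃ f : ℕ → ℕ, Computable f ∧ ∀ φ : Sent L, (φ.onLang ι).code = f φ.code

/-! The core is the truth of `Φ` in the standard model, shown by a minimal counterexample in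
`IsSelfCons.trueInNat`. All members of the Group-2 schema `θ` are true, because each reflects only
theorems of `(𝓑, D)` that are true by hypothesis. Suppose `Φ` is false. It is a `Π₁` sentence, so it
fails on some segment of numbers `< 2 ^ N`; take `N` least. The segment for `N = 0` is `{0}`, which
contains no code of a sentence, so `N = J + 1`, and then `♯(θ ∪ {Φ}) = J`. The counterexample below
`2 ^ (J + 1)` contains codes `p`, `q` of proofs from `θ ∪ B ∪ {Φ}` of a `Π_k` sentence and of its
negation. Both logarithms are below `♯(θ ∪ {Φ}) + 1`, so stability applies to the R-View `θ ∪ {Φ}`,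
although this view contains a false sentence.

For `k = 1`, A-stability makes the `Π₁` sentence correct for arguments below `2 ^ (J / 2)`, while
E-stability puts witnesses for its negation below `2 ^ (⌊log q⌋ / 2 - 1)`, within that range. For `k
= 0`, each stability notion makes both a `Δ₀` sentence and its negation true. Either way this is
absurd.

Truth of `Φ` yields Level(k) consistency, since an actual inconsistency would be a counterexample to
`Φ`. Full consistency follows because a contradiction would prove everything. For a `Π₁` theorem `Ψ`
of `(𝓑, D)`, the existence of its proof is a true `Σ₁` sentence, hence provable from `B`, and the
reflection axiom then gives `Ψ`.

The existence claims need r.e. relations to be expressed by `Δ₀` formulas with a witness variable.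
This is done through the β-function (`sigmaDef_of_partrec`), together with the effectiveness of the
syntax: substitution acts symbol by symbol on strings (`tokens_subst`), and codes are injective by
unique readability. Self-reference needs no separate fixed-point theorem, as the provability formula
itself speaks of `Γ(T_m)` with `m` the code of `Γ`. -/

namespace Fml

variable {L : FirstOrder.Language.{0, 0}}

/-! ### Substitution -/

/-- The substitution under one quantifier. -/
def liftSubst {m n : ℕ} (σ : Fin m → L.Term (Fin n)) : Fin (m + 1) → L.Term (Fin (n + 1)) :=
  Fin.snoc (fun i => (σ i).relabel Fin.castSucc) (FirstOrder.Language.Term.var (Fin.last n))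

@[simp] theorem liftSubst_castSucc {m n : ℕ} (σ : Fin m → L.Term (Fin n)) (i : Fin m) :
    liftSubst σ i.castSucc = (σ i).relabel Fin.castSucc := by
  simp [liftSubst]

@[simp] theorem liftSubst_last {m n : ℕ} (σ : Fin m → L.Term (Fin n)) :
    liftSubst σ (Fin.last m) = FirstOrder.Language.Term.var (Fin.last n) := by
  simp [liftSubst]

theorem term_subst_subst {α β γ : Type} (t : L.Term α) (σ : α → L.Term β) (τ : β → L.Term γ) :
    (t.subst σ).subst τ = t.subst fun i => (σ i).subst τ := by
  induction t with
  | var => rfl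
  | func f ts ih => simp only [FirstOrder.Language.Term.subst, ih]

theorem term_relabel_eq_subst {α β : Type} (t : L.Term α) (f : α → β) :
    t.relabel f = t.subst fun i => FirstOrder.Language.Term.var (f i) := by
  induction t with
  | var => rfl
  | func f ts ih => simp only [FirstOrder.Language.Term.subst, FirstOrder.Language.Term.relabel, ih]

theorem liftSubst_comp {l m n : ℕ} (σ : Fin l → L.Term (Fin m)) (τ : Fin m → L.Term (Fin n)) :
    (fun i => (liftSubst σ i).subst (liftSubst τ)) = liftSubst fun i => (σ i).subst τ := by
  funext i
  refine Fin.lastCases ?_ (fun i => ?_) i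
  · simp [FirstOrder.Language.Term.subst]
  · simp [term_relabel_eq_subst, term_subst_subst, FirstOrder.Language.Term.subst]

theorem subst_subst {l m n : ℕ} (φ : Fml L l) (σ : Fin l → L.Term (Fin m))
    (τ : Fin m → L.Term (Fin n)) :
    (φ.subst σ).subst τ = φ.subst fun i => (σ i).subst τ := by
  induction φ generalizing m n with
  | eq | rel => simp only [subst, term_subst_subst]
  | neg φ ih => simp only [subst, ih]
  | and φ ψ ih₁ ih₂ | or φ ψ ih₁ ih₂ | imp φ ψ ih₁ ih₂ => simp only [subst, ih₁, ih₂]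
  | ball T φ ih | bex T φ ih =>
    simp only [subst, term_subst_subst, ih]
    exact congrArg _ (congrArg _ (liftSubst_comp σ τ))
  | all φ ih | ex φ ih =>
    simp only [subst, ih]
    exact congrArg _ (congrArg _ (liftSubst_comp σ τ))

theorem rename_subst {l m n : ℕ} (φ : Fml L l) (f : Fin l → Fin m) (τ : Fin m → L.Term (Fin n)) :
    (φ.rename f).subst τ = φ.subst fun i => τ (f i) :=
  subst_subst φ _ τ

theorem subst_rename {l m n : ℕ} (φ : Fml L l) (σ : Fin l → L.Term (Fin m)) (f : Fin m → Fin n) :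
    (φ.subst σ).rename f = φ.subst fun i => (σ i).relabel f := by
  simp only [rename, subst_subst, term_relabel_eq_subst]

/-! ### Semantics -/

theorem realize_liftSubst {M : Type} [L.Structure M] {m n : ℕ} (σ : Fin m → L.Term (Fin n))
    (v : Fin n → M) (a : M) :
    (fun i => (liftSubst σ i).realize (Fin.snoc v a : Fin (n + 1) → M)) =
      (Fin.snoc (fun i => (σ i).realize v) a : Fin (m + 1) → M) := by
  funext i
  refine Fin.lastCases ?_ (fun i => ?_) i
  · simp
  · simp [Function.comp_def]

section Semantics

variable [L.IsOrdered] {M : Type} [L.Structure M]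

theorem realizeOn_subst {m n : ℕ} (R : Set M) (φ : Fml L m) (σ : Fin m → L.Term (Fin n))
    (v : Fin n → M) :
    (φ.subst σ).RealizeOn R v ↔ φ.RealizeOn R fun i => (σ i).realize v := by
  induction φ generalizing n with
  | eq => simp [subst, RealizeOn]
  | rel => simp [subst, RealizeOn]
  | neg φ ih => simp only [subst, RealizeOn, ih]
  | and φ ψ ih₁ ih₂ | or φ ψ ih₁ ih₂ | imp φ ψ ih₁ ih₂ => simp only [subst, RealizeOn, ih₁, ih₂]
  | ball T φ ih | bex T φ ih =>
    simp only [subst, RealizeOn, ih, FirstOrder.Language.Term.realize_subst]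
    simp only [← realize_liftSubst]
    rfl
  | all φ ih | ex φ ih =>
    simp only [subst, RealizeOn, ih]
    simp only [← realize_liftSubst]
    rfl

theorem realizeOn_rename {m n : ℕ} (R : Set M) (φ : Fml L m) (f : Fin m → Fin n)
    (v : Fin n → M) : (φ.rename f).RealizeOn R v ↔ φ.RealizeOn R fun i => v (f i) :=
  realizeOn_subst R φ _ v

theorem realize_subst {m n : ℕ} (φ : Fml L m) (σ : Fin m → L.Term (Fin n)) (v : Fin n → M) :
    (φ.subst σ).Realize v ↔ φ.Realize fun i => (σ i).realize v :=
  realizeOn_subst _ φ σ v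

theorem realize_rename {m n : ℕ} (φ : Fml L m) (f : Fin m → Fin n) (v : Fin n → M) :
    (φ.rename f).Realize v ↔ φ.Realize fun i => v (f i) :=
  realizeOn_rename _ φ f v

/-- Only unbounded quantifiers consult `R`. Restricted truth of a `Π₁` sentence therefore reduces to
plain truth of its matrix at arguments taken from `R`. -/
theorem FullyBounded.realizeOn_iff {n : ℕ} {φ : Fml L n} (h : φ.FullyBounded) (R : Set M)
    (v : Fin n → M) : φ.RealizeOn R v ↔ φ.Realize v := by
  unfold Realize
  induction φ with
  | eq | rel => rfl
  | neg φ ih => simp only [RealizeOn, ih h]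
  | and φ ψ ih₁ ih₂ | or φ ψ ih₁ ih₂ | imp φ ψ ih₁ ih₂ =>
    simp only [RealizeOn, ih₁ h.1, ih₂ h.2]
  | ball T φ ih | bex T φ ih =>
    have h : φ.FullyBounded := h
    simp only [RealizeOn, ih h]
  | all | ex => exact h.elim

theorem realizeOn_allClosure (R : Set M) {k : ℕ} (φ : Fml L k) (v : Fin 0 → M) :
    φ.allClosure.RealizeOn R v ↔ ∀ u : Fin k → M, (∀ i, u i ∈ R) → φ.RealizeOn R u := by
  induction k with
  | zero =>
    refine ⟨fun h u _ => ?_, fun h => h v fun i => i.elim0⟩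
    rwa [Subsingleton.elim u v]
  | succ k ih =>
    refine (ih (all φ)).trans ⟨fun h u hu => ?_, fun h u hu a ha => ?_⟩
    · have := h (Fin.init u) (fun i => hu _) (u (Fin.last k)) (hu _)
      rwa [Fin.snoc_init_self] at this
    · refine h _ fun i => ?_
      refine Fin.lastCases ?_ (fun i => ?_) i
      · simpa using ha
      · simpa using hu i

theorem realize_allClosure {k : ℕ} (φ : Fml L k) (v : Fin 0 → M) :
    φ.allClosure.Realize v ↔ ∀ u : Fin k → M, φ.Realize u :=
  (realizeOn_allClosure _ φ v).trans (by simp [Realize])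

/-- `∃ v₀ ∃ v₁ … ∃ vₖ₋₁ φ`. -/
def exClosure : {k : ℕ} → Fml L k → Sent L
  | 0, φ => φ
  | _ + 1, φ => exClosure (ex φ)

theorem realizeOn_exClosure (R : Set M) {k : ℕ} (φ : Fml L k) (v : Fin 0 → M) :
    φ.exClosure.RealizeOn R v ↔ ∃ u : Fin k → M, (∀ i, u i ∈ R) ∧ φ.RealizeOn R u := by
  induction k with
  | zero =>
    refine ⟨fun h => ⟨v, fun i => i.elim0, h⟩, fun ⟨u, _, h⟩ => ?_⟩
    rwa [Subsingleton.elim u v] at h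
  | succ k ih =>
    refine (ih (ex φ)).trans ⟨fun ⟨u, hu, a, ha, h⟩ => ⟨_, fun i => ?_, h⟩, fun ⟨u, hu, h⟩ => ?_⟩
    · refine Fin.lastCases ?_ (fun i => ?_) i
      · simpa using ha
      · simpa using hu i
    · refine ⟨Fin.init u, fun i => hu _, u (Fin.last k), hu _, ?_⟩
      rwa [Fin.snoc_init_self]

end Semantics

/-! ### Prenex sentences -/

theorem FullyBounded.prenexNeg {n : ℕ} {φ : Fml L n} (h : φ.FullyBounded) :
    φ.prenexNeg = neg φ := by
  cases φ <;> first | rfl | exact h.elim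

/-- The induction moves quantifiers into `φ`, which then is no longer fully bounded; an arbitrary
value `ψ` of `prenexNeg` survives this step. -/
theorem prenexNeg_allClosure_of_eq {k : ℕ} {φ ψ : Fml L k} (h : φ.prenexNeg = ψ) :
    φ.allClosure.prenexNeg = ψ.exClosure := by
  induction k with
  | zero => exact h
  | succ k ih => exact ih (congrArg ex h)

theorem prenexNeg_allClosure {k : ℕ} {φ : Fml L k} (h : φ.FullyBounded) :
    φ.allClosure.prenexNeg = (neg φ).exClosure :=
  prenexNeg_allClosure_of_eq h.prenexNeg

end Fml

section Prenex

variable {L : FirstOrder.Language.{0, 0}} {Δ : ∀ n, Set (Fml L n)}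

theorem Prenex.of_mem {b : Bool} {n : ℕ} {φ : Fml L n} (h : φ ∈ Δ n) : Prenex Δ b 1 φ :=
  .step (.zero h)

theorem Prenex.mem_of_zero {b : Bool} {n : ℕ} {φ : Fml L n} (h : Prenex Δ b 0 φ) : φ ∈ Δ n := by
  cases h; assumption

theorem Prenex.allClosure {k : ℕ} {φ : Fml L k} (h : Prenex Δ true 1 φ) :
    Prenex Δ true 1 φ.allClosure := by
  induction k with
  | zero => exact h
  | succ k ih => exact ih h.all

theorem Prenex.exClosure {k : ℕ} {φ : Fml L k} (h : Prenex Δ false 1 φ) :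
    Prenex Δ false 1 φ.exClosure := by
  induction k with
  | zero => exact h
  | succ k ih => exact ih h.ex

/-- Closing `all φ` and closing `φ` give the same sentence by definition, so with all free variables
closed the quantifier case is trivial. The equations `hb` and `hj` keep the indices free for the
induction. -/
theorem Prenex.exists_allClosure {b : Bool} {j n : ℕ} {φ : Fml L n} (h : Prenex Δ b j φ)
    (hb : b = true) (hj : j = 1) :
    ∃ (k : ℕ) (ψ : Fml L k), ψ ∈ Δ k ∧ φ.allClosure = ψ.allClosure := by
  induction h with
  | zero => omega
  | @step b k n φ h =>
    obtain rfl : k = 0 := by omega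
    exact ⟨n, φ, h.mem_of_zero, rfl⟩
  | all h ih => exact ih rfl hj
  | ex => cases hb

theorem prenex_true_one_iff {t : Sent L} :
    Prenex Δ true 1 t ↔ ∃ (k : ℕ) (φ : Fml L k), φ ∈ Δ k ∧ t = φ.allClosure := by
  refine ⟨fun h => h.exists_allClosure rfl rfl, ?_⟩
  rintro ⟨k, φ, hφ, rfl⟩
  exact (Prenex.of_mem hφ).allClosure

end Prenex

/-! ### Symbol strings -/

namespace Fml

/-- The action of a substitution on a symbol. The first variables are replaced by the strings in
`T`, the later ones are renumbered so that they start from `n`. -/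
def substToken (T : List (List ℕ)) (n x : ℕ) : List ℕ :=
  if x.unpair.1 = 0 then T[x.unpair.2]?.getD [Nat.pair 0 (n + (x.unpair.2 - T.length))] else [x]

theorem substToken_pair_of_ne (T : List (List ℕ)) (n : ℕ) {a : ℕ} (h : a ≠ 0) (b : ℕ) :
    substToken T n (Nat.pair a b) = [Nat.pair a b] := by
  simp [substToken, h]

/-- Passing a quantifier appends the new variable `n` to the list of replacements, which is exactly
what the renumbering of later variables already produces. So one map on symbols serves at every
quantifier depth. -/
theorem substToken_concat (T : List (List ℕ)) (n : ℕ) :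
    substToken (T ++ [ [Nat.pair 0 n] ]) (n + 1) = substToken T n := by
  funext x
  unfold substToken
  split_ifs with h
  · rcases lt_trichotomy x.unpair.2 T.length with h | h | h
    · rw [List.getElem?_append_left h, List.getElem?_eq_getElem h]
      rfl
    · rw [h]
      simp
    · rw [List.getElem?_eq_none (by simp; omega), List.getElem?_eq_none h.le]
      simp only [Option.getD_none, List.length_append, List.length_singleton]
      congr 2
      omega
  · rfl

theorem flatMap_flatten {α β : Type} (f : α → List β) (l : List (List α)) :
    l.flatten.flatMap f = (l.map fun x => x.flatMap f).flatten := by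
  induction l with
  | nil => rfl
  | cons a l ih => simp [ih]

/-! ### Unique readability of terms, and substitution on their strings -/

section Terms

variable {L : FirstOrder.Language.{0, 0}} [∀ k, Encodable (L.Functions k)]

theorem flatten_termTokens_inj {n k : ℕ} {ts us : Fin k → L.Term (Fin n)}
    (ih : ∀ i (t : L.Term (Fin n)) (l l' : List ℕ),
      termTokens (ts i) ++ l = termTokens t ++ l' → ts i = t ∧ l = l') {l l' : List ℕ}
    (h : (List.ofFn fun i => termTokens (ts i)).flatten ++ l =
      (List.ofFn fun i => termTokens (us i)).flatten ++ l') : ts = us ∧ l = l' := by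
  induction k with
  | zero => exact ⟨funext fun i => i.elim0, by simpa using h⟩
  | succ k ih' =>
    simp only [List.ofFn_succ, List.flatten_cons, List.append_assoc] at h
    obtain ⟨h₀, h⟩ := ih 0 _ _ _ h
    obtain ⟨h₁, h⟩ := ih' (ts := fun i => ts i.succ) (us := fun i => us i.succ)
      (fun i => ih i.succ) h
    exact ⟨funext fun i => Fin.cases h₀ (congrFun h₁) i, h⟩

/-- Prefix notation with arities stored in the function symbols is self-delimiting. The arbitrary
continuations `l` and `l'` let the induction read off one argument after another. -/
theorem termTokens_append_inj {n : ℕ} (s t : L.Term (Fin n)) (l l' : List ℕ)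
    (h : termTokens s ++ l = termTokens t ++ l') : s = t ∧ l = l' := by
  induction s generalizing t l l' with
  | var i =>
    cases t with
    | var j =>
      simp only [termTokens, List.cons_append, List.nil_append, List.cons.injEq,
        Nat.pair_eq_pair, true_and] at h
      exact ⟨congrArg _ (Fin.ext h.1), h.2⟩
    | func => simp [termTokens] at h
  | @func k f ts ih =>
    cases t with
    | var => simp [termTokens] at h
    | func g us =>
      simp only [termTokens, List.cons_append, List.cons.injEq, Nat.pair_eq_pair, true_and] at h
      obtain ⟨⟨rfl, h₁⟩, h₂⟩ := h
      obtain ⟨rfl, h₃⟩ := flatten_termTokens_inj ih h₂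
      rw [Encodable.encode_injective h₁]
      exact ⟨rfl, h₃⟩

theorem termTokens_relabel_castSucc {n : ℕ} (t : L.Term (Fin n)) :
    termTokens (t.relabel Fin.castSucc) = termTokens t := by
  induction t with
  | var => rfl
  | func f ts ih => simp only [FirstOrder.Language.Term.relabel, termTokens, ih]

theorem termTokens_relabel_elim0 {n : ℕ} (t : L.Term (Fin 0)) :
    termTokens (t.relabel (Fin.elim0 : Fin 0 → Fin n)) = termTokens t := by
  induction t with
  | var i => exact i.elim0
  | func f ts ih => simp only [FirstOrder.Language.Term.relabel, termTokens, ih]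

theorem ofFn_termTokens_liftSubst {m n : ℕ} (σ : Fin m → L.Term (Fin n)) :
    (List.ofFn fun i => termTokens (liftSubst σ i)) =
      (List.ofFn fun i => termTokens (σ i)) ++ [ [Nat.pair 0 n] ] := by
  rw [List.ofFn_succ_last]
  simp [termTokens_relabel_castSucc, termTokens]

theorem termTokens_subst {m n : ℕ} (t : L.Term (Fin m)) (σ : Fin m → L.Term (Fin n)) :
    termTokens (t.subst σ) =
      (termTokens t).flatMap (substToken (List.ofFn fun i => termTokens (σ i)) n) := by
  induction t with
  | var i => simp [FirstOrder.Language.Term.subst, termTokens, substToken]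
  | func f ts ih =>
    simp only [FirstOrder.Language.Term.subst, termTokens, ih, List.flatMap_cons,
      substToken_pair_of_ne _ _ one_ne_zero, flatMap_flatten, List.map_ofFn]
    rfl

end Terms

/-! ### Unique readability of formulas, and substitution on their strings -/

variable {L : FirstOrder.Language.{0, 0}} [∀ k, Encodable (L.Functions k)]
  [∀ k, Encodable (L.Relations k)]

theorem tokens_append_inj {n : ℕ} (φ χ : Fml L n) (l l' : List ℕ)
    (h : φ.tokens ++ l = χ.tokens ++ l') : φ = χ ∧ l = l' := by
  induction φ generalizing l l' with
  | eq s t =>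
    cases χ <;> simp only [tokens, List.cons_append, List.cons.injEq, Nat.pair_eq_pair,
      List.append_assoc, true_and] at h <;> try omega
    obtain ⟨rfl, h₁⟩ := termTokens_append_inj _ _ _ _ h
    obtain ⟨rfl, h₂⟩ := termTokens_append_inj _ _ _ _ h₁
    exact ⟨rfl, h₂⟩
  | rel R ts =>
    cases χ <;> simp only [tokens, List.cons_append, List.cons.injEq, Nat.pair_eq_pair,
      List.append_assoc, true_and] at h <;> try omega
    obtain ⟨⟨rfl, h₁⟩, h₂⟩ := h
    obtain ⟨rfl, h₃⟩ := flatten_termTokens_inj (fun i => termTokens_append_inj _) h₂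
    rw [Encodable.encode_injective h₁]
    exact ⟨rfl, h₃⟩
  | neg φ ih | all φ ih | ex φ ih =>
    cases χ <;> simp only [tokens, List.cons_append, List.cons.injEq, Nat.pair_eq_pair,
      List.append_assoc, true_and] at h <;> try omega
    obtain ⟨rfl, h₁⟩ := ih _ _ _ h
    exact ⟨rfl, h₁⟩
  | and φ ψ ih₁ ih₂ | or φ ψ ih₁ ih₂ | imp φ ψ ih₁ ih₂ =>
    cases χ <;> simp only [tokens, List.cons_append, List.cons.injEq, Nat.pair_eq_pair,
      List.append_assoc, true_and] at h <;> try omega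
    obtain ⟨rfl, h₁⟩ := ih₁ _ _ _ h
    obtain ⟨rfl, h₂⟩ := ih₂ _ _ _ h₁
    exact ⟨rfl, h₂⟩
  | ball T φ ih | bex T φ ih =>
    cases χ <;> simp only [tokens, List.cons_append, List.cons.injEq, Nat.pair_eq_pair,
      List.append_assoc, true_and] at h <;> try omega
    obtain ⟨rfl, h₁⟩ := termTokens_append_inj _ _ _ _ h
    obtain ⟨rfl, h₂⟩ := ih _ _ _ h₁
    exact ⟨rfl, h₂⟩

theorem tokens_injective {n : ℕ} : Function.Injective (tokens : Fml L n → List ℕ) :=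
  fun φ ψ h => (tokens_append_inj φ ψ [] [] (by simpa using h)).1

theorem code_injective {n : ℕ} : Function.Injective (code : Fml L n → ℕ) :=
  fun _ _ h => tokens_injective (Encodable.encode_injective h)

theorem tokens_ne_nil {n : ℕ} (φ : Fml L n) : φ.tokens ≠ [] := by
  cases φ <;> simp [tokens]

theorem code_ne_zero {n : ℕ} (φ : Fml L n) : φ.code ≠ 0 := by
  intro h
  refine φ.tokens_ne_nil (Encodable.encode_injective (α := List ℕ) (h.trans ?_))
  simp

/-- Bound variables are numbered by depth from the outside, so a term placed under a quantifier
keeps its string. Substitution thus becomes a context-free replacement of symbols, which is visibly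
computable. -/
theorem tokens_subst {m n : ℕ} (φ : Fml L m) (σ : Fin m → L.Term (Fin n)) :
    (φ.subst σ).tokens =
      φ.tokens.flatMap (substToken (List.ofFn fun i => termTokens (σ i)) n) := by
  induction φ generalizing n with
  | rel R ts =>
    simp only [subst, tokens, termTokens_subst, List.flatMap_cons,
      substToken_pair_of_ne _ _ three_ne_zero, flatMap_flatten, List.map_ofFn]
    rfl
  | eq => simp [subst, tokens, termTokens_subst, substToken_pair_of_ne]
  | neg φ ih => simp [subst, tokens, ih, substToken_pair_of_ne]
  | and φ ψ ih₁ ih₂ | or φ ψ ih₁ ih₂ | imp φ ψ ih₁ ih₂ =>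
    simp [subst, tokens, ih₁, ih₂, substToken_pair_of_ne]
  | ball T φ ih | bex T φ ih =>
    have := ih (liftSubst σ)
    rw [ofFn_termTokens_liftSubst, substToken_concat] at this
    simp only [subst, tokens, List.flatMap_cons, List.flatMap_append, ← termTokens_subst, ← this,
      substToken_pair_of_ne _ _ two_ne_zero]
    rfl
  | all φ ih | ex φ ih =>
    have := ih (liftSubst σ)
    rw [ofFn_termTokens_liftSubst, substToken_concat] at this
    simp only [subst, tokens, List.flatMap_cons, ← this,
      substToken_pair_of_ne _ _ two_ne_zero]
    rfl

theorem tokens_allClosure {k : ℕ} (φ : Fml L k) :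
    φ.allClosure.tokens = List.replicate k (Nat.pair 2 7) ++ φ.tokens := by
  induction k with
  | zero => rfl
  | succ k ih =>
    rw [allClosure, ih, List.replicate_succ', List.append_assoc]
    rfl

theorem tokens_exClosure {k : ℕ} (φ : Fml L k) :
    φ.exClosure.tokens = List.replicate k (Nat.pair 2 8) ++ φ.tokens := by
  induction k with
  | zero => rfl
  | succ k ih =>
    rw [exClosure, ih, List.replicate_succ', List.append_assoc]
    rfl

end Fml

/-! ### The order on the naturals, tuples, and primitive recursion by sequences -/

theorem FirstOrder.Language.relMap_leSymb_nat {L : FirstOrder.Language.{0, 0}} [L.IsOrdered]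
    [L.Structure ℕ] [L.OrderedStructure ℕ] (a b : ℕ) :
    FirstOrder.Language.Structure.RelMap
      (FirstOrder.Language.leSymb : L.Relations 2) ![a, b] ↔ a ≤ b := by
  simp

/-- The matrix of a `SigmaDef` lists its witness `w` last. To quantify `a` inside the scope of `w`,
the last two places must be exchanged. -/
theorem snoc_snoc_swap {n : ℕ} (v : Fin n → ℕ) (w a : ℕ) :
    (fun i => (Fin.snoc (Fin.snoc v w : Fin (n + 1) → ℕ) a : Fin (n + 2) → ℕ)
      ((Fin.snoc (Fin.snoc (fun i : Fin n => i.castSucc.castSucc) (Fin.last (n + 1)) :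
        Fin (n + 1) → Fin (n + 2)) (Fin.last n).castSucc : Fin (n + 2) → Fin (n + 2)) i)) =
      (Fin.snoc (Fin.snoc v a : Fin (n + 1) → ℕ) w : Fin (n + 2) → ℕ) := by
  funext i
  refine Fin.lastCases ?_ (fun i => ?_) i
  · simp
  · refine Fin.lastCases ?_ (fun i => ?_) i <;> simp

/-- A value of a function defined by primitive recursion is computed by a finite sequence. -/
theorem Part.mem_natRec_iff {a : Part ℕ} {g : ℕ → ℕ → Part ℕ} (n z : ℕ) :
    z ∈ (Nat.rec a (fun y IH => IH.bind (g y)) n : Part ℕ) ↔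
      ∃ (l : List ℕ) (_ : l.length = n + 1),
        l[n] = z ∧ l[0] ∈ a ∧ ∀ y (_ : y < n), l[y + 1] ∈ g y l[y] := by
  induction n generalizing z with
  | zero =>
    refine ⟨fun h => ⟨[z], rfl, rfl, h, fun y hy => absurd hy (Nat.not_lt_zero y)⟩, ?_⟩
    rintro ⟨l, hl, rfl, h, -⟩
    exact h
  | succ n ih =>
    refine Part.mem_bind_iff.trans ?_
    simp only [ih]
    constructor
    · rintro ⟨_, ⟨l, hl, rfl, h₀, h⟩, hz⟩
      refine ⟨l ++ [z], by simp [hl], by simp [hl], ?_, fun y hy => ?_⟩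
      · rwa [List.getElem_append_left (by omega)]
      · rw [List.getElem_append_left (i := y) (by omega)]
        rcases (Nat.lt_succ_iff.1 hy).lt_or_eq with hy | rfl
        · rw [List.getElem_append_left (by omega)]
          exact h y hy
        · rw [List.getElem_append_right (by omega)]
          simpa [hl] using hz
    · rintro ⟨l, hl, rfl, h₀, h⟩
      refine ⟨l[n], ⟨l.take (n + 1), by simp [hl], by simp, by simpa using h₀, fun y hy => ?_⟩,
        h n (Nat.lt_succ_self n)⟩
      simpa using h y (by omega)

namespace GenericConfiguration

variable {L : FirstOrder.Language.{0, 0}} [L.IsOrdered] [L.Structure ℕ] [L.OrderedStructure ℕ]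
  [∀ k, Encodable (L.Functions k)] [∀ k, Encodable (L.Relations k)]

/-! ### Relations definable by bounded formulas -/

/-- The relation `S` is defined by a `Δ₀` formula. -/
def DeltaDef (ξ : GenericConfiguration L) {n : ℕ} (S : (Fin n → ℕ) → Prop) : Prop :=
  ∃ φ ∈ ξ.Delta n, ∀ v, φ.Realize v ↔ S v

variable {ξ : GenericConfiguration L}

namespace DeltaDef

theorem congr {n : ℕ} {S T : (Fin n → ℕ) → Prop} (h : ξ.DeltaDef S) (e : ∀ v, T v ↔ S v) :
    ξ.DeltaDef T :=
  let ⟨φ, hφ, hS⟩ := h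
  ⟨φ, hφ, fun v => (hS v).trans (e v).symm⟩

theorem comp {m n : ℕ} {S : (Fin m → ℕ) → Prop} (h : ξ.DeltaDef S) (f : Fin m → Fin n) :
    ξ.DeltaDef fun v => S fun i => v (f i) :=
  let ⟨φ, hφ, hS⟩ := h
  ⟨φ.rename f, ξ.rename_mem f hφ, fun v => (Fml.realize_rename φ f v).trans (hS _)⟩

theorem not {n : ℕ} {S : (Fin n → ℕ) → Prop} (h : ξ.DeltaDef S) : ξ.DeltaDef fun v => ¬ S v :=
  let ⟨φ, hφ, hS⟩ := h
  ⟨.neg φ, ξ.neg_mem hφ, fun v => not_congr (hS v)⟩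

theorem and {n : ℕ} {S T : (Fin n → ℕ) → Prop} (hS : ξ.DeltaDef S) (hT : ξ.DeltaDef T) :
    ξ.DeltaDef fun v => S v ∧ T v :=
  let ⟨φ, hφ, h⟩ := hS
  let ⟨ψ, hψ, h'⟩ := hT
  ⟨.and φ ψ, ξ.and_mem hφ hψ, fun v => and_congr (h v) (h' v)⟩

theorem or {n : ℕ} {S T : (Fin n → ℕ) → Prop} (hS : ξ.DeltaDef S) (hT : ξ.DeltaDef T) :
    ξ.DeltaDef fun v => S v ∨ T v :=
  let ⟨φ, hφ, h⟩ := hS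
  let ⟨ψ, hψ, h'⟩ := hT
  ⟨.or φ ψ, ξ.or_mem hφ hψ, fun v => or_congr (h v) (h' v)⟩

theorem ball {n : ℕ} {S : (Fin (n + 1) → ℕ) → Prop} (h : ξ.DeltaDef S) (i : Fin n) :
    ξ.DeltaDef fun v : Fin n → ℕ => ∀ a ≤ v i, S (Fin.snoc v a) :=
  let ⟨φ, hφ, hS⟩ := h
  ⟨.ball (.var i) φ, ξ.ball_mem i hφ, fun v => forall_congr' fun a =>
    imp_congr (FirstOrder.Language.relMap_leSymb_nat (L := L) a (v i)) (hS _)⟩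

theorem bex {n : ℕ} {S : (Fin (n + 1) → ℕ) → Prop} (h : ξ.DeltaDef S) (i : Fin n) :
    ξ.DeltaDef fun v : Fin n → ℕ => ∃ a ≤ v i, S (Fin.snoc v a) :=
  let ⟨φ, hφ, hS⟩ := h
  ⟨.bex (.var i) φ, ξ.bex_mem i hφ, fun v => exists_congr fun a =>
    and_congr (FirstOrder.Language.relMap_leSymb_nat (L := L) a (v i)) (hS _)⟩

variable (ξ) in
theorem eq {n : ℕ} (i j : Fin n) : ξ.DeltaDef fun v : Fin n → ℕ => v i = v j :=
  ⟨_, ξ.var_eq_var_mem i j, fun _ => Iff.rfl⟩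

theorem _root_.GenericConfiguration.realize_num (ξ : GenericConfiguration L) (n k : ℕ)
    (v : Fin n → ℕ) : (ξ.num n k).realize v = k := by
  refine FirstOrder.Language.Term.realize_relabel.trans (Eq.trans ?_ (ξ.numeral_std k))
  exact congrArg (ξ.numeral k).realize (Subsingleton.elim (α := Fin 0 → ℕ) _ _)

variable (ξ) in
theorem eq_const {n : ℕ} (i : Fin n) (k : ℕ) : ξ.DeltaDef fun v : Fin n → ℕ => v i = k :=
  ⟨_, ξ.var_eq_numeral_mem i k, fun v => by
    show v i = (ξ.num n k).realize v ↔ _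
    rw [realize_num]⟩

variable (ξ) in
theorem add {n : ℕ} (i j k : Fin n) : ξ.DeltaDef fun v : Fin n → ℕ => v i + v j = v k := by
  obtain ⟨φ, hφ, h⟩ := ξ.add_mem
  refine ⟨φ.rename ![i, j, k], ξ.rename_mem _ hφ, fun v => ?_⟩
  refine (Fml.realize_rename φ _ v).trans (Iff.trans ?_ (h _ _ _))
  refine iff_of_eq (congrArg φ.Realize (funext fun x => ?_))
  fin_cases x <;> rfl

variable (ξ) in
theorem mul {n : ℕ} (i j k : Fin n) : ξ.DeltaDef fun v : Fin n → ℕ => v i * v j = v k := by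
  obtain ⟨φ, hφ, h⟩ := ξ.mult_mem
  refine ⟨φ.rename ![i, j, k], ξ.rename_mem _ hφ, fun v => ?_⟩
  refine (Fml.realize_rename φ _ v).trans (Iff.trans ?_ (h _ _ _))
  refine iff_of_eq (congrArg φ.Realize (funext fun x => ?_))
  fin_cases x <;> rfl

variable (ξ) in
theorem le {n : ℕ} (i j : Fin n) : ξ.DeltaDef fun v : Fin n → ℕ => v i ≤ v j :=
  -- Atomic formulas with `≤` are not assumed to be `Δ₀`; the bounded quantifier in `∃ a ≤ v j, a =
  -- v i` replaces them.
  ((eq ξ (n := n + 1) (Fin.last n) i.castSucc).bex j).congr fun v => by simp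

end DeltaDef

/-! ### Existential closures of bounded formulas -/

/-- The relation `R` is defined by a `Δ₀` formula preceded by one existential quantifier. -/
def SigmaDef (ξ : GenericConfiguration L) {n : ℕ} (R : (Fin n → ℕ) → Prop) : Prop :=
  ∃ S : (Fin (n + 1) → ℕ) → Prop, ξ.DeltaDef S ∧ ∀ v, R v ↔ ∃ w : ℕ, S (Fin.snoc v w)

namespace SigmaDef

theorem congr {n : ℕ} {S T : (Fin n → ℕ) → Prop} (h : ξ.SigmaDef S) (e : ∀ v, T v ↔ S v) :
    ξ.SigmaDef T :=
  let ⟨U, hU, hS⟩ := h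
  ⟨U, hU, fun v => (e v).trans (hS v)⟩

/-- The existential quantifier may be bounded by a witness that can be enlarged at will. -/
theorem exists_mono {n : ℕ} {R : (Fin n → ℕ) → Prop} (h : ξ.SigmaDef R) :
    ∃ S : (Fin (n + 1) → ℕ) → Prop, ξ.DeltaDef S ∧ (∀ v, R v ↔ ∃ w : ℕ, S (Fin.snoc v w)) ∧
      ∀ (v : Fin n → ℕ) (w w' : ℕ), w ≤ w' → S (Fin.snoc v w) → S (Fin.snoc v w') := by
  obtain ⟨S, hS, hR⟩ := h
  have key : ∀ (v : Fin n → ℕ) (w a : ℕ),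
      (fun i => (Fin.snoc (Fin.snoc v w : Fin (n + 1) → ℕ) a : Fin (n + 2) → ℕ)
        ((Fin.snoc (fun i : Fin n => i.castSucc.castSucc) (Fin.last (n + 1)) :
          Fin (n + 1) → Fin (n + 2)) i)) = (Fin.snoc v a : Fin (n + 1) → ℕ) := by
    intro v w a
    funext i
    refine Fin.lastCases ?_ (fun i => ?_) i <;> simp
  refine ⟨_, (hS.comp (Fin.snoc (fun i => i.castSucc.castSucc) (Fin.last (n + 1)) :
    Fin (n + 1) → Fin (n + 2))).bex (Fin.last n), fun v => ?_, fun v w w' hw => ?_⟩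
  · simp only [key, Fin.snoc_last, hR]
    exact ⟨fun ⟨w, h⟩ => ⟨w, w, le_rfl, h⟩, fun ⟨_, w, _, h⟩ => ⟨w, h⟩⟩
  · simp only [key, Fin.snoc_last]
    exact fun ⟨a, ha, h⟩ => ⟨a, ha.trans hw, h⟩

theorem of_delta {n : ℕ} {S : (Fin n → ℕ) → Prop} (h : ξ.DeltaDef S) : ξ.SigmaDef S :=
  ⟨_, h.comp Fin.castSucc, fun v => by simp⟩

theorem comp {m n : ℕ} {R : (Fin m → ℕ) → Prop} (h : ξ.SigmaDef R) (f : Fin m → Fin n) :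
    ξ.SigmaDef fun v => R fun i => v (f i) := by
  obtain ⟨S, hS, hR⟩ := h
  refine ⟨_, hS.comp (Fin.snoc (fun i => (f i).castSucc) (Fin.last n) : Fin (m + 1) → Fin (n + 1)),
    fun v => (hR _).trans (exists_congr fun w => iff_of_eq (congrArg S (funext fun i => ?_)))⟩
  refine Fin.lastCases ?_ (fun i => ?_) i <;> simp

theorem and {n : ℕ} {Q R : (Fin n → ℕ) → Prop} (hQ : ξ.SigmaDef Q) (hR : ξ.SigmaDef R) :
    ξ.SigmaDef fun v => Q v ∧ R v := by
  obtain ⟨S, hS, hQ, mS⟩ := hQ.exists_mono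
  obtain ⟨T, hT, hR, mT⟩ := hR.exists_mono
  refine ⟨_, hS.and hT, fun v => ?_⟩
  simp only [hQ, hR]
  exact ⟨fun ⟨⟨a, ha⟩, b, hb⟩ => ⟨max a b, mS _ _ _ (le_max_left _ _) ha,
    mT _ _ _ (le_max_right _ _) hb⟩, fun ⟨w, h, h'⟩ => ⟨⟨w, h⟩, w, h'⟩⟩

theorem or {n : ℕ} {Q R : (Fin n → ℕ) → Prop} (hQ : ξ.SigmaDef Q) (hR : ξ.SigmaDef R) :
    ξ.SigmaDef fun v => Q v ∨ R v := by
  obtain ⟨S, hS, hQ⟩ := hQ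
  obtain ⟨T, hT, hR⟩ := hR
  refine ⟨_, hS.or hT, fun v => ?_⟩
  simp only [hQ, hR, exists_or]

theorem ex {n : ℕ} {R : (Fin (n + 1) → ℕ) → Prop} (h : ξ.SigmaDef R) :
    ξ.SigmaDef fun v : Fin n → ℕ => ∃ a : ℕ, R (Fin.snoc v a) := by
  obtain ⟨S, hS, hR, mS⟩ := h.exists_mono
  refine ⟨_, (hS.comp (Fin.snoc (Fin.snoc (fun i => i.castSucc.castSucc) (Fin.last (n + 1)) :
    Fin (n + 1) → Fin (n + 2)) (Fin.last n).castSucc : Fin (n + 2) → Fin (n + 2))).bex (Fin.last n),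
    fun v => ?_⟩
  simp only [snoc_snoc_swap, Fin.snoc_last, hR]
  exact ⟨fun ⟨a, w, h⟩ => ⟨max a w, a, le_max_left _ _, mS _ _ _ (le_max_right _ _) h⟩,
    fun ⟨w, a, _, h⟩ => ⟨a, w, h⟩⟩

/-- This is collection: the finitely many `a ≤ v j` have witnesses with a common upper bound, and by
monotonicity that bound is a witness for all of them. -/
theorem ball {n : ℕ} {R : (Fin (n + 1) → ℕ) → Prop} (h : ξ.SigmaDef R) (j : Fin n) :
    ξ.SigmaDef fun v : Fin n → ℕ => ∀ a ≤ v j, R (Fin.snoc v a) := by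
  obtain ⟨S, hS, hR, mS⟩ := h.exists_mono
  refine ⟨_, (hS.comp (Fin.snoc (Fin.snoc (fun i => i.castSucc.castSucc) (Fin.last (n + 1)) :
    Fin (n + 1) → Fin (n + 2)) (Fin.last n).castSucc : Fin (n + 2) → Fin (n + 2))).ball j.castSucc,
    fun v => ?_⟩
  simp only [snoc_snoc_swap, Fin.snoc_castSucc, hR]
  refine ⟨fun h => ?_, fun ⟨w, h⟩ a ha => ⟨w, h a ha⟩⟩
  choose! f hf using h
  exact ⟨(Finset.Iic (v j)).sup f, fun a ha =>
    mS _ _ _ (Finset.le_sup (Finset.mem_Iic.2 ha)) (hf a ha)⟩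

/-! ### Arithmetic -/

variable (ξ) in
theorem eq {n : ℕ} (i j : Fin n) : ξ.SigmaDef fun v : Fin n → ℕ => v i = v j :=
  of_delta (.eq ξ i j)

variable (ξ) in
theorem eq_const {n : ℕ} (i : Fin n) (k : ℕ) : ξ.SigmaDef fun v : Fin n → ℕ => v i = k :=
  of_delta (.eq_const ξ i k)

variable (ξ) in
theorem lt {n : ℕ} (i j : Fin n) : ξ.SigmaDef fun v : Fin n → ℕ => v i < v j :=
  of_delta ((DeltaDef.le ξ j i).not.congr fun v => by simp)

variable (ξ) in
theorem add {n : ℕ} (i j k : Fin n) : ξ.SigmaDef fun v : Fin n → ℕ => v i + v j = v k :=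
  of_delta (.add ξ i j k)

variable (ξ) in
theorem mul {n : ℕ} (i j k : Fin n) : ξ.SigmaDef fun v : Fin n → ℕ => v i * v j = v k :=
  of_delta (.mul ξ i j k)

theorem rel₂ {n : ℕ} {R : ℕ → ℕ → Prop} (h : ξ.SigmaDef fun v : Fin 2 → ℕ => R (v 0) (v 1))
    (i j : Fin n) : ξ.SigmaDef fun v : Fin n → ℕ => R (v i) (v j) :=
  h.comp ![i, j]

theorem rel₃ {n : ℕ} {R : ℕ → ℕ → ℕ → Prop}
    (h : ξ.SigmaDef fun v : Fin 3 → ℕ => R (v 0) (v 1) (v 2)) (i j k : Fin n) :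
    ξ.SigmaDef fun v : Fin n → ℕ => R (v i) (v j) (v k) :=
  h.comp ![i, j, k]

variable (ξ) in
theorem succ {n : ℕ} (i j : Fin n) : ξ.SigmaDef fun v : Fin n → ℕ => v i + 1 = v j :=
  rel₂ (R := fun a b => a + 1 = b) (((((eq_const ξ (2 : Fin 3) 1).and (add ξ 0 2 1)).ex).congr
    fun v => (by simp [Fin.snoc] : v 0 + 1 = v 1 ↔ _))) i j

variable (ξ) in
-- Only the graphs of addition and multiplication are available, so every intermediate value is
-- named by an existential quantifier, and `exists_eq_left'` removes the names again. The same
-- method serves for `mod` and `beta`.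
theorem pair {n : ℕ} (i j k : Fin n) :
    ξ.SigmaDef fun v : Fin n → ℕ => Nat.pair (v i) (v j) = v k := by
  refine rel₃ (R := fun a b c => Nat.pair a b = c) ?_ i j k
  have h₁ : ξ.SigmaDef fun v : Fin 3 → ℕ => ∃ s, v 1 * v 1 = s ∧ s + v 0 = v 2 :=
    ((mul ξ (1 : Fin 4) 1 3).and (add ξ 3 0 2)).ex
  have h₂ : ξ.SigmaDef fun v : Fin 3 → ℕ => ∃ s, v 0 * v 0 = s ∧ ∃ t, s + v 0 = t ∧ t + v 1 = v 2 :=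
    ((mul ξ (0 : Fin 4) 0 3).and ((add ξ (3 : Fin 5) 0 4).and (add ξ 4 1 2)).ex).ex
  refine (((lt ξ 0 1).and h₁).or ((of_delta (.le ξ 1 0)).and h₂)).congr fun v => ?_
  simp only [Nat.pair, exists_eq_left']
  split_ifs with h
  · simp [h]
  · simp [h]
    omega

variable (ξ) in
theorem mod {n : ℕ} (i j k : Fin n) :
    ξ.SigmaDef fun v : Fin n → ℕ => v i % (v j + 1) = v k := by
  refine rel₃ (R := fun a b c => a % (b + 1) = c) ?_ i j k
  have h : ξ.SigmaDef fun v : Fin 3 → ℕ => ∃ m, v 1 + 1 = m ∧ (v 2 < m ∧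
      ∃ q, ∃ s, m * q = s ∧ s + v 2 = v 0) :=
    ((succ ξ (1 : Fin 4) 3).and ((lt ξ 2 3).and
      ((mul ξ (3 : Fin 6) 4 5).and (add ξ 5 2 0)).ex.ex)).ex
  refine h.congr fun v => ?_
  simp only [exists_eq_left']
  constructor
  · intro h
    exact ⟨h ▸ Nat.mod_lt _ (Nat.succ_pos _), v 0 / (v 1 + 1), by
      rw [← h]; exact Nat.div_add_mod _ _⟩
  · rintro ⟨h, q, hq⟩
    rw [← hq, Nat.mul_add_mod, Nat.mod_eq_of_lt h]

variable (ξ) in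
theorem beta {n : ℕ} (i j k : Fin n) :
    ξ.SigmaDef fun v : Fin n → ℕ => Nat.beta (v i) (v j) = v k := by
  refine rel₃ (R := fun a b c => Nat.beta a b = c) ?_ i j k
  have h : ξ.SigmaDef fun v : Fin 3 → ℕ => ∃ a b, Nat.pair a b = v 0 ∧ ∃ s, v 1 + 1 = s ∧
      ∃ t, s * b = t ∧ a % (t + 1) = v 2 :=
    ((pair ξ (3 : Fin 5) 4 0).and ((succ ξ (1 : Fin 6) 5).and
      ((mul ξ (5 : Fin 7) 4 6).and (mod ξ 3 6 2)).ex).ex).ex.ex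
  refine h.congr fun v => ?_
  simp only [exists_eq_left']
  constructor
  · intro h
    exact ⟨_, _, Nat.pair_unpair _, h⟩
  · rintro ⟨a, b, h, h'⟩
    rw [← h'.trans rfl, ← h]
    simp [Nat.beta]

end SigmaDef

/-- The graph of every partial recursive function is definable by a `Δ₀` formula preceded by one
existential quantifier. -/
theorem sigmaDef_of_partrec (ξ : GenericConfiguration L) {f : ℕ →. ℕ} (hf : Nat.Partrec f) :
    ξ.SigmaDef fun v : Fin 2 → ℕ => v 1 ∈ f (v 0) := by
  induction hf with
  | zero => exact (SigmaDef.eq_const ξ 1 0).congr fun v => by simp [pure, PFun.pure]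
  | succ => exact (SigmaDef.succ ξ 0 1).congr fun v => by simp [eq_comm]
  | left =>
    refine (SigmaDef.pair ξ (1 : Fin 3) 2 0).ex.congr fun v => ?_
    show v 1 ∈ Part.some (v 0).unpair.1 ↔ ∃ a, Nat.pair (v 1) a = v 0
    rw [Part.mem_some_iff]
    exact ⟨fun h => ⟨_, by rw [h, Nat.pair_unpair]⟩, fun ⟨a, h⟩ => by rw [← h, Nat.unpair_pair]⟩
  | right =>
    refine (SigmaDef.pair ξ (2 : Fin 3) 1 0).ex.congr fun v => ?_
    show v 1 ∈ Part.some (v 0).unpair.2 ↔ ∃ a, Nat.pair a (v 1) = v 0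
    rw [Part.mem_some_iff]
    exact ⟨fun h => ⟨_, by rw [h, Nat.pair_unpair]⟩, fun ⟨a, h⟩ => by rw [← h, Nat.unpair_pair]⟩
  | @pair f g _ _ ihf ihg =>
    have h : ξ.SigmaDef fun v : Fin 2 → ℕ => ∃ a b, a ∈ f (v 0) ∧ b ∈ g (v 0) ∧
        Nat.pair a b = v 1 :=
      ((ihf.rel₂ (R := fun x y => y ∈ f x) (0 : Fin 4) 2).and
        ((ihg.rel₂ (R := fun x y => y ∈ g x) 0 3).and (.pair ξ 2 3 1))).ex.ex
    refine h.congr fun v => ?_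
    simp [Seq.seq]
  | @comp f g _ _ ihf ihg =>
    have h : ξ.SigmaDef fun v : Fin 2 → ℕ => ∃ a, a ∈ g (v 0) ∧ v 1 ∈ f a :=
      ((ihg.rel₂ (R := fun x y => y ∈ g x) (0 : Fin 3) 2).and
        (ihf.rel₂ (R := fun x y => y ∈ f x) 2 1)).ex
    exact h.congr fun v => Part.mem_bind_iff
  | @prec f g _ _ ihf ihg =>
    have hstep : ξ.SigmaDef fun v : Fin 4 → ℕ => ∃ s, v 3 + 1 = s ∧
        ∃ i, Nat.beta (v 2) (v 3) = i ∧ ∃ j, Nat.beta (v 2) s = j ∧ ∃ k, Nat.pair (v 3) i = k ∧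
        ∃ l, Nat.pair (v 0) k = l ∧ j ∈ g l :=
      ((SigmaDef.succ ξ (3 : Fin 5) 4).and ((SigmaDef.beta ξ (2 : Fin 6) 3 5).and
        ((SigmaDef.beta ξ (2 : Fin 7) 4 6).and ((SigmaDef.pair ξ (3 : Fin 8) 5 7).and
        ((SigmaDef.pair ξ (0 : Fin 9) 7 8).and
          (ihg.rel₂ (R := fun x y => y ∈ g x) 8 6)).ex).ex).ex).ex).ex
    -- Here `v` lists the parameter, the number of steps and the β-code of the sequence of values.
    -- The recursion step is needed only below `v 1`, while the bounded quantifier includes `v 1`;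
    -- the first disjunct exempts it.
    have hall : ξ.SigmaDef fun v : Fin 3 → ℕ => ∀ y ≤ v 1, (y = v 1 ∨ ∃ s, y + 1 = s ∧
        ∃ i, Nat.beta (v 2) y = i ∧ ∃ j, Nat.beta (v 2) s = j ∧ ∃ k, Nat.pair y i = k ∧
        ∃ l, Nat.pair (v 0) k = l ∧ j ∈ g l) :=
      ((SigmaDef.eq ξ (3 : Fin 4) 1).or hstep).ball 1
    have hzero : ξ.SigmaDef fun v : Fin 3 → ℕ => ∃ z, z = 0 ∧ ∃ i, Nat.beta (v 2) z = i ∧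
        i ∈ f (v 0) :=
      ((SigmaDef.eq_const ξ (3 : Fin 4) 0).and ((SigmaDef.beta ξ (2 : Fin 5) 3 4).and
        (ihf.rel₂ (R := fun x y => y ∈ f x) 0 4)).ex).ex
    have h : ξ.SigmaDef fun v : Fin 2 → ℕ => ∃ x a n, Nat.pair a n = v 0 ∧ ∃ c,
        Nat.beta c n = v 1 ∧ (∃ z, z = 0 ∧ ∃ i, Nat.beta c z = i ∧ i ∈ f a) ∧
          ∀ y ≤ n, (y = n ∨ ∃ s, y + 1 = s ∧
          ∃ i, Nat.beta c y = i ∧ ∃ j, Nat.beta c s = j ∧ ∃ k, Nat.pair y i = k ∧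
          ∃ l, Nat.pair a k = l ∧ j ∈ g l) :=
      ((SigmaDef.pair ξ (3 : Fin 5) 4 0).and ((SigmaDef.beta ξ (5 : Fin 6) 4 1).and
        ((hzero.comp (![3, 4, 5] : Fin 3 → Fin 6)).and
          (hall.comp (![3, 4, 5] : Fin 3 → Fin 6)))).ex).ex.ex.ex
    refine h.congr fun v => ?_
    simp only [exists_eq_left', exists_eq_left, exists_const]
    obtain ⟨a, n, hv⟩ : ∃ a n, v 0 = Nat.pair a n := ⟨_, _, (Nat.pair_unpair _).symm⟩
    simp only [hv, Nat.unpaired, Nat.unpair_pair, Nat.pair_eq_pair]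
    refine (Part.mem_natRec_iff (g := fun y i => g (Nat.pair a (Nat.pair y i))) n (v 1)).trans ?_
    constructor
    · rintro ⟨l, hl, h₁, h₀, h⟩
      have hb : ∀ i (hi : i < l.length), Nat.beta (Nat.unbeta l) i = l[i] :=
        fun i hi => Nat.beta_unbeta_coe l ⟨i, hi⟩
      refine ⟨a, n, ⟨rfl, rfl⟩, Nat.unbeta l, ?_, ?_, fun y hy => ?_⟩
      · rw [hb _ (by omega), h₁]
      · rwa [hb _ (by omega)]
      · rcases hy.lt_or_eq with hy | rfl
        · right
          rw [hb _ (by omega), hb _ (by omega)]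
          exact h y hy
        · exact Or.inl rfl
    · rintro ⟨a', n', ⟨h₂, h₃⟩, c, h₁, h₀, h⟩
      subst h₂ h₃
      -- Any `c` codes some sequence, so the values are read off from `c` without knowing where it
      -- came from.
      refine ⟨(List.range (n' + 1)).map (Nat.beta c), by simp, by simpa using h₁,
        by simpa using h₀, fun y hy => ?_⟩
      simpa using (h y hy.le).resolve_left hy.ne
  | @rfind f _ ihf =>
    have h : ξ.SigmaDef fun v : Fin 2 → ℕ => (∃ o, o = 0 ∧ ∃ p, Nat.pair (v 0) (v 1) = p ∧ o ∈ f p) ∧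
        ∀ m ≤ v 1, (m = v 1 ∨ ∃ p, Nat.pair (v 0) m = p ∧ ∃ k, ∃ k', k + 1 = k' ∧ k' ∈ f p) :=
      ((SigmaDef.eq_const ξ (2 : Fin 3) 0).and ((SigmaDef.pair ξ (0 : Fin 4) 1 3).and
        (ihf.rel₂ (R := fun x y => y ∈ f x) 3 2)).ex).ex.and
      (((SigmaDef.eq ξ (2 : Fin 3) 1).or ((SigmaDef.pair ξ (0 : Fin 4) 2 3).and
        ((SigmaDef.succ ξ (4 : Fin 6) 5).and
          (ihf.rel₂ (R := fun x y => y ∈ f x) 3 5)).ex.ex).ex).ball 1)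
    refine h.congr fun v => ?_
    simp only [exists_eq_left', exists_eq_left]
    refine Nat.mem_rfind.trans (and_congr ?_ ⟨fun h m hm => ?_, fun h m hm => ?_⟩)
    · simp
    · rcases hm.lt_or_eq with hm | rfl
      · obtain ⟨a, ha, h'⟩ := (Part.mem_map_iff _).1 (h hm)
        obtain ⟨k, rfl⟩ := Nat.exists_eq_succ_of_ne_zero (by simpa using h' : a ≠ 0)
        exact Or.inr ⟨k, ha⟩
      · exact Or.inl rfl
    · obtain ⟨k, hk⟩ := (h m hm.le).resolve_left hm.ne
      exact (Part.mem_map_iff _).2 ⟨_, hk, by simp⟩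

end GenericConfiguration

/-! ### Closure properties of the recursively enumerable predicates -/

namespace REPred

variable {α β : Type} [Primcodable α] [Primcodable β] {p q : α → Prop}

theorem comp {p : β → Prop} (h : REPred p) {f : α → β} (hf : Computable f) :
    REPred fun a => p (f a) :=
  Partrec.comp h hf

/-- The stage is the step bound of `evaln`. Stages are decidable and increasing, which turns a
conjunction of two searches into one search up to the maximum. -/
theorem exists_stage (h : REPred p) : ∃ s : α → ℕ → Prop, PrimrecRel s ∧
    (∀ a m n, m ≤ n → s a m → s a n) ∧ ∀ a, p a ↔ ∃ n, s a n := by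
  obtain ⟨c, hc⟩ := Nat.Partrec.Code.exists_code.1 h
  refine ⟨fun a n => (c.evaln n (Encodable.encode a)).isSome = true, ?_, ?_, fun a => ?_⟩
  · refine Primrec.eq.comp (Primrec.option_isSome.comp (Nat.Partrec.Code.primrec_evaln.comp
      ((Primrec.snd.pair (Primrec.const c)).pair (Primrec.encode.comp Primrec.fst))))
      (Primrec.const true)
  · intro a m n hmn hm
    obtain ⟨x, hx⟩ := Option.isSome_iff_exists.1 hm
    exact Option.isSome_iff_exists.2 ⟨x, Nat.Partrec.Code.evaln_mono hmn hx⟩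
  · have : p a ↔ ∃ x, x ∈ c.eval (Encodable.encode a) := by
      rw [hc]
      simp [Part.mem_assert_iff]
    rw [this]
    simp only [Nat.Partrec.Code.evaln_complete, Option.isSome_iff_exists]
    exact exists_comm

theorem of_stage {s : α → ℕ → Prop} (hs : PrimrecRel s) : REPred fun a => ∃ n, s a n := by
  obtain ⟨hd, hs⟩ := hs
  have h : Partrec fun a => Nat.rfind fun n => Part.some (@decide (s a n) (hd (a, n))) :=
    Partrec.rfind hs.to_comp.partrec
  refine h.dom_re.of_eq fun a => ?_
  refine Nat.rfind_dom.trans ⟨fun ⟨n, h, _⟩ => ⟨n, ?_⟩, fun ⟨n, h⟩ => ⟨n, ?_, fun _ => trivial⟩⟩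
  · exact @of_decide_eq_true _ (hd (a, n)) (Part.mem_some_iff.1 h).symm
  · exact Part.mem_some_iff.2 (@decide_eq_true _ (hd (a, n)) h).symm

theorem and (hp : REPred p) (hq : REPred q) : REPred fun a => p a ∧ q a := by
  obtain ⟨s, hs, ms, hp⟩ := hp.exists_stage
  obtain ⟨t, ht, mt, hq⟩ := hq.exists_stage
  refine (of_stage (s := fun a n => s a n ∧ t a n) (PrimrecPred.and hs ht)).of_eq fun a => ?_
  rw [hp, hq]
  exact ⟨fun ⟨n, h, h'⟩ => ⟨⟨n, h⟩, n, h'⟩, fun ⟨⟨m, h⟩, n, h'⟩ => ⟨max m n,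
    ms _ _ _ (le_max_left _ _) h, mt _ _ _ (le_max_right _ _) h'⟩⟩

theorem or (hp : REPred p) (hq : REPred q) : REPred fun a => p a ∨ q a := by
  obtain ⟨s, hs, -, hp⟩ := hp.exists_stage
  obtain ⟨t, ht, -, hq⟩ := hq.exists_stage
  refine (of_stage (s := fun a n => s a n ∨ t a n) (PrimrecPred.or hs ht)).of_eq fun a => ?_
  rw [hp, hq, exists_or]

theorem exists_right {p : α × β → Prop} (h : REPred p) : REPred fun a => ∃ b, p (a, b) := by
  obtain ⟨s, hs, -, hp⟩ := h.exists_stage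
  -- The number `n` pairs a code of `b` with a stage. Decoding is partial, so its result is kept as
  -- a list of length at most one, and the search for `b` becomes a quantifier over a list.
  have hl : Primrec fun n : ℕ =>
      ((Encodable.decode n.unpair.1 : Option β).elim [] fun b => [b]) := by
    refine (Primrec.option_casesOn (Primrec.decode.comp (Primrec.fst.comp Primrec.unpair))
      (Primrec.const []) (Primrec.list_cons.comp Primrec.snd (Primrec.const [])).to₂).of_eq
      fun n => ?_
    cases (Encodable.decode n.unpair.1 : Option β) <;> rfl
  have hR : PrimrecRel fun (b : β) (x : α × ℕ) => s (x.1, b) x.2 :=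
    hs.comp ((Primrec.fst.comp Primrec.snd).pair Primrec.fst) (Primrec.snd.comp Primrec.snd)
  refine (of_stage (s := fun a n =>
    ∃ b ∈ ((Encodable.decode n.unpair.1 : Option β).elim [] fun b => [b]), s (a, b) n.unpair.2)
    (hR.exists_mem_list.comp (hl.comp Primrec.snd) (Primrec.fst.pair
      (Primrec.snd.comp (Primrec.unpair.comp Primrec.snd))))).of_eq fun a => ?_
  simp only [hp]
  constructor
  · rintro ⟨n, b, -, h⟩
    exact ⟨b, _, h⟩
  · rintro ⟨b, n, h⟩
    exact ⟨Nat.pair (Encodable.encode b) n, b, by simp, by simpa using h⟩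

/-- A finite list needs only finitely many stages, and the largest one works for all entries. This
is what makes "all cited axioms belong to the system" an r.e. condition. -/
theorem forall_mem {p : α × β → Prop} (h : REPred p) :
    REPred fun x : α × List β => ∀ b ∈ x.2, p (x.1, b) := by
  obtain ⟨s, hs, ms, hp⟩ := h.exists_stage
  have hR : PrimrecRel fun (b : β) (x : α × ℕ) => s (x.1, b) x.2 :=
    hs.comp ((Primrec.fst.comp Primrec.snd).pair Primrec.fst) (Primrec.snd.comp Primrec.snd)
  refine (of_stage (s := fun (x : α × List β) n => ∀ b ∈ x.2, s (x.1, b) n)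
    (hR.forall_mem_list.comp (Primrec.snd.comp Primrec.fst) ((Primrec.fst.comp Primrec.fst).pair
      Primrec.snd))).of_eq fun x => ?_
  simp only [hp]
  obtain ⟨a, l⟩ := x
  induction l with
  | nil => simp
  | cons b l ih =>
    simp only [List.forall_mem_cons, ← ih]
    exact ⟨fun ⟨n, h, h'⟩ => ⟨⟨n, h⟩, n, h'⟩, fun ⟨⟨m, h⟩, n, h'⟩ => ⟨max m n,
      ms _ _ _ (le_max_left _ _) h, fun b hb => ms _ _ _ (le_max_right _ _) (h' b hb)⟩⟩

theorem eq {f g : α → β} (hf : Computable f) (hg : Computable g) : REPred fun a => f a = g a := by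
  have h : PrimrecRel fun x y : ℕ => x = y := Primrec.eq
  have h' : REPred fun x : ℕ × ℕ => x.1 = x.2 := by
    obtain ⟨_, h⟩ := h
    exact ComputablePred.to_re ⟨_, h.to_comp⟩
  exact (h'.comp ((Computable.encode.comp hf).pair (Computable.encode.comp hg))).of_eq
    fun a => Encodable.encode_inj

/-- The image of an r.e. predicate under a computable function is r.e. -/
theorem image {p : β → Prop} (h : REPred p) {f : β → α} (hf : Computable f) :
    REPred fun a => ∃ b, p b ∧ a = f b :=
  exists_right (p := fun x : α × β => p x.2 ∧ x.1 = f x.2)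
    ((h.comp Computable.snd).and (eq Computable.fst (hf.comp Computable.snd)))

end REPred

/-! ### Effectiveness of operations on symbol strings -/

theorem Fml.primrec_flatMap_substToken :
    Primrec fun x : List (List ℕ) × ℕ × List ℕ => x.2.2.flatMap (Fml.substToken x.1 x.2.1) := by
  refine Primrec.list_flatMap (Primrec.snd.comp Primrec.snd) ?_
  unfold Primrec₂ Fml.substToken
  have hx : Primrec fun y : (List (List ℕ) × ℕ × List ℕ) × ℕ => y.2.unpair :=
    Primrec.unpair.comp Primrec.snd
  have hT : Primrec fun y : (List (List ℕ) × ℕ × List ℕ) × ℕ => y.1.1 :=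
    Primrec.fst.comp Primrec.fst
  have hn : Primrec fun y : (List (List ℕ) × ℕ × List ℕ) × ℕ => y.1.2.1 :=
    Primrec.fst.comp (Primrec.snd.comp Primrec.fst)
  refine Primrec.ite (Primrec.eq.comp (Primrec.fst.comp hx) (Primrec.const 0)) ?_
    (Primrec.list_cons.comp Primrec.snd (Primrec.const []))
  refine Primrec.option_getD.comp (Primrec.list_getElem?.comp hT (Primrec.snd.comp hx)) ?_
  refine Primrec.list_cons.comp (Primrec₂.natPair.comp (Primrec.const 0) ?_) (Primrec.const [])
  exact Primrec.nat_add.comp hn (Primrec.nat_sub.comp (Primrec.snd.comp hx)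
    (Primrec.list_length.comp hT))

theorem Fml.computable_flatMap_substToken {α : Type} [Primcodable α] {T : α → List (List ℕ)}
    {n : α → ℕ} {l : α → List ℕ} (hT : Computable T) (hn : Computable n) (hl : Computable l) :
    Computable fun x => (l x).flatMap (Fml.substToken (T x) (n x)) :=
  Fml.primrec_flatMap_substToken.to_comp.comp (hT.pair (hn.pair hl))

theorem Primrec.list_replicate_const {α : Type} [Primcodable α] (a : α) :
    Primrec fun n : ℕ => List.replicate n a :=
  (Primrec.list_map Primrec.list_range (Primrec.const a).to₂).of_eq fun n => by simp

/-- The symbol string with a given code. -/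
def decodeTokens (c : ℕ) : List ℕ := (Encodable.decode c).getD []

theorem primrec_decodeTokens : Primrec decodeTokens :=
  Primrec.option_getD.comp Primrec.decode (Primrec.const [])

@[simp]
theorem Fml.decodeTokens_code {L : FirstOrder.Language.{0, 0}} [∀ k, Encodable (L.Functions k)]
    [∀ k, Encodable (L.Relations k)] {n : ℕ} (φ : Fml L n) : decodeTokens φ.code = φ.tokens := by
  simp [decodeTokens, Fml.code]

/-! ### Formulas for r.e. relations -/

namespace GenericConfiguration

variable {L : FirstOrder.Language.{0, 0}} [L.IsOrdered] [L.Structure ℕ] [L.OrderedStructure ℕ]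
  [∀ k, Encodable (L.Functions k)] [∀ k, Encodable (L.Relations k)]

theorem sigmaDef_of_rePred (ξ : GenericConfiguration L) {p : ℕ → Prop} (h : REPred p) :
    ξ.SigmaDef fun v : Fin 1 → ℕ => p (v 0) := by
  refine ((ξ.sigmaDef_of_partrec h).comp (![0, 1] : Fin 2 → Fin 2)).ex.congr fun v => ?_
  simp [Part.mem_assert_iff, Fin.snoc]

theorem sigmaDef_of_rePred₃ (ξ : GenericConfiguration L) {p : ℕ × ℕ × ℕ → Prop} (h : REPred p) :
    ξ.SigmaDef fun v : Fin 3 → ℕ => p (v 0, v 1, v 2) := by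
  have h₁ : REPred fun n : ℕ => p (n.unpair.1, n.unpair.2.unpair.1, n.unpair.2.unpair.2) :=
    h.comp ((Primrec.fst.comp Primrec.unpair).pair
      (Primrec.unpair.comp (Primrec.snd.comp Primrec.unpair))).to_comp
  have h₂ : ξ.SigmaDef fun v : Fin 3 → ℕ => ∃ a b, Nat.pair (v 1) (v 2) = a ∧
      Nat.pair (v 0) a = b ∧ p (b.unpair.1, b.unpair.2.unpair.1, b.unpair.2.unpair.2) :=
    ((SigmaDef.pair ξ (1 : Fin 5) 2 3).and ((SigmaDef.pair ξ (0 : Fin 5) 3 4).and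
      ((ξ.sigmaDef_of_rePred h₁).comp (![4] : Fin 1 → Fin 5)))).ex.ex
  refine h₂.congr fun v => ?_
  simp

/-- An r.e. relation is expressed by a `Δ₀` formula with a witness variable. -/
theorem exists_delta_of_rePred₂ (ξ : GenericConfiguration L) {p : ℕ × ℕ → Prop} (h : REPred p) :
    ∃ N ∈ ξ.Delta 3, ∀ x y : ℕ, (∃ w : ℕ, N.Realize ![x, y, w]) ↔ p (x, y) := by
  obtain ⟨S, ⟨φ, hφ, hS⟩, hR⟩ := (ξ.sigmaDef_of_rePred₃ (p := fun x => p (x.1, x.2.1))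
    (h.comp (Computable.fst.pair (Computable.fst.comp Computable.snd)))).comp
    (![0, 1, 1] : Fin 3 → Fin 2)
  refine ⟨φ, hφ, fun x y => Iff.trans ?_ (hR ![x, y]).symm⟩
  refine exists_congr fun w => (hS _).trans (iff_of_eq (congrArg S (funext fun i => ?_)))
  fin_cases i <;> rfl

theorem subst_mem_of_forall_var (ξ : GenericConfiguration L) {m n : ℕ} {φ : Fml L m}
    (hφ : φ ∈ ξ.Delta m) (σ : Fin m → L.Term (Fin n))
    (h : ∀ i, ∃ j, σ i = FirstOrder.Language.Term.var j) : φ.subst σ ∈ ξ.Delta n := by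
  choose f hf using h
  rw [funext hf]
  exact ξ.rename_mem f hφ

/-- An r.e. relation is expressed by a `Δ₀` formula with a witness variable whose instances for
numerals in the first variable are `Δ₀`. -/
theorem exists_delta_of_rePred₃ (ξ : GenericConfiguration L) {p : ℕ × ℕ × ℕ → Prop}
    (h : REPred p) : ∃ S ∈ ξ.Delta 4,
      (∀ m : ℕ, S.subst ![ξ.num 3 m, FirstOrder.Language.Term.var 0,
        FirstOrder.Language.Term.var 1, FirstOrder.Language.Term.var 2] ∈ ξ.Delta 3) ∧
      ∀ x y z : ℕ, (∃ w : ℕ, S.Realize ![x, y, z, w]) ↔ p (x, y, z) := by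
  obtain ⟨S, ⟨φ, hφ, hS⟩, hR⟩ := ξ.sigmaDef_of_rePred₃ h
  -- `Δ₀` is not assumed closed under substitution of numerals. So the first variable is confined to
  -- the equation `a = x`, whose numeral instances are `Δ₀` by assumption, and `φ` receives `a`
  -- instead. The new witness bounds both `a` and the witness of `φ`.
  refine ⟨.bex (.var 3) (.and (.eq (.var 4) (.var 0))
    (.bex (.var 3) (φ.rename (![4, 1, 2, 5] : Fin 4 → Fin 6)))), ?_, fun m => ?_, fun x y z => ?_⟩
  · exact ξ.bex_mem _ (ξ.and_mem (ξ.var_eq_var_mem _ _) (ξ.bex_mem _ (ξ.rename_mem _ hφ)))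
  · refine ξ.bex_mem (2 : Fin 3) (ξ.and_mem ?_ (ξ.bex_mem (2 : Fin 4) ?_))
    · have e : (ξ.num 3 m).relabel Fin.castSucc = (ξ.numeral m).relabel Fin.elim0 :=
        (FirstOrder.Language.Term.relabel_relabel _ _ _).trans
          (congrArg (ξ.numeral m).relabel (Subsingleton.elim (α := Fin 0 → Fin 4) _ _))
      have h := ξ.var_eq_numeral_mem (3 : Fin 4) m
      rwa [← e] at h
    · rw [Fml.rename_subst]
      refine ξ.subst_mem_of_forall_var hφ _ fun i => ?_
      fin_cases i <;> exact ⟨_, rfl⟩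
  · have key : ∀ w a b : ℕ, ((φ.rename (![4, 1, 2, 5] : Fin 4 → Fin 6)).Realize
        (Fin.snoc (Fin.snoc ![x, y, z, w] a : Fin 5 → ℕ) b : Fin 6 → ℕ)) ↔
        S (Fin.snoc ![a, y, z] b : Fin 4 → ℕ) := by
      intro w a b
      refine (Fml.realize_rename φ _ _).trans ((hS _).trans
        (iff_of_eq (congrArg S (funext fun i => ?_))))
      fin_cases i <;> rfl
    have h₁ : ∀ w : ℕ, Fml.Realize (.bex (.var 3) (.and (.eq (.var 4) (.var 0))
        (.bex (.var 3) (φ.rename (![4, 1, 2, 5] : Fin 4 → Fin 6))))) ![x, y, z, w] ↔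
        ∃ a ≤ w, a = x ∧ ∃ b ≤ w, S (Fin.snoc ![a, y, z] b : Fin 4 → ℕ) := fun w =>
      exists_congr fun a => and_congr (FirstOrder.Language.relMap_leSymb_nat (L := L) a w)
        (and_congr Iff.rfl (exists_congr fun b =>
          and_congr (FirstOrder.Language.relMap_leSymb_nat (L := L) b w) (key w a b)))
    refine (exists_congr h₁).trans (Iff.trans ?_ (hR ![x, y, z]).symm)
    constructor
    · rintro ⟨w, _, -, rfl, b, -, h⟩
      exact ⟨b, h⟩
    · rintro ⟨b, h⟩
      exact ⟨max x b, x, le_max_left _ _, rfl, b, le_max_right _ _, h⟩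

end GenericConfiguration

/-! ### Recursively enumerable sets of sentences -/

namespace Fml

variable {L : FirstOrder.Language.{0, 0}} [∀ k, Encodable (L.Functions k)]
  [∀ k, Encodable (L.Relations k)]

theorem IsRE.union {α β : Set (Sent L)} (hα : IsRE α) (hβ : IsRE β) : IsRE (α ∪ β) :=
  (REPred.or hα hβ).of_eq fun c => by
    simp only [Set.mem_union, or_and_right, exists_or]

theorem isRE_singleton (φ : Sent L) : IsRE {φ} :=
  (REPred.eq (Computable.const φ.code) Computable.id).of_eq fun c => by simp

theorem exists_mem_code_iff {n : ℕ} {α : Set (Fml L n)} {φ : Fml L n} :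
    (∃ ψ ∈ α, ψ.code = φ.code) ↔ φ ∈ α :=
  ⟨fun ⟨_, hψ, h⟩ => code_injective h ▸ hψ, fun h => ⟨φ, h, rfl⟩⟩

end Fml

/-- Provability from a uniformly r.e. family of axiom systems is r.e. -/
theorem ProofNumbering.rePred_prf {L : FirstOrder.Language.{0, 0}}
    [∀ k, Encodable (L.Functions k)] [∀ k, Encodable (L.Relations k)] {d : DeductionMethod L}
    (g : ProofNumbering d) {q : ℕ × ℕ → Prop} (hq : REPred q) :
    REPred fun x : ℕ × ℕ × ℕ => ∃ τ : Sent L, τ.code = x.2.1 ∧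
      d.Prf g {a | q (x.1, a.code)} τ x.2.2 := by
  have h₁ : REPred fun y : (ℕ × ℕ × ℕ) × List ℕ => ∃ π A t, d.Derives π A t ∧
      g.num π = y.1.2.2 ∧ t.code = y.1.2.1 ∧ A.map Fml.code = y.2 :=
    g.effective.comp (f := fun y : (ℕ × ℕ × ℕ) × List ℕ => (y.1.2.2, y.1.2.1, y.2))
      ((Primrec.snd.comp (Primrec.snd.comp Primrec.fst)).pair
        ((Primrec.fst.comp (Primrec.snd.comp Primrec.fst)).pair Primrec.snd)).to_comp
  have h₂ : REPred fun y : (ℕ × ℕ × ℕ) × List ℕ => ∀ a ∈ y.2, q (y.1.1, a) :=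
    hq.forall_mem.comp (f := fun y : (ℕ × ℕ × ℕ) × List ℕ => (y.1.1, y.2))
      ((Primrec.fst.comp Primrec.fst).pair Primrec.snd).to_comp
  refine (h₁.and h₂).exists_right.of_eq fun x => ?_
  constructor
  · rintro ⟨_, ⟨π, A, t, hd, hp, ht, rfl⟩, hA⟩
    exact ⟨t, ht, π, ⟨A, hd, fun a ha => hA _ (List.mem_map_of_mem ha)⟩, hp⟩
  · rintro ⟨t, ht, π, ⟨A, hd, hA⟩, hp⟩
    refine ⟨_, ⟨π, A, t, hd, hp, ht, rfl⟩, fun c hc => ?_⟩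
    obtain ⟨a, ha, rfl⟩ := List.mem_map.1 hc
    exact hA a ha

namespace DeductionMethod

variable {L : FirstOrder.Language.{0, 0}} {d : DeductionMethod L}

theorem ProofFrom.mono {α β : Set (Sent L)} (h : α ⊆ β) {t : Sent L} {π : d.Proof}
    (hπ : d.ProofFrom α t π) : d.ProofFrom β t π :=
  let ⟨A, hd, hA⟩ := hπ
  ⟨A, hd, fun a ha => h (hA a ha)⟩

theorem Proves.mono {α β : Set (Sent L)} (h : α ⊆ β) {t : Sent L} (ht : d.Proves α t) :
    d.Proves β t :=
  let ⟨π, hπ⟩ := ht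
  ⟨π, hπ.mono h⟩

end DeductionMethod

theorem Fml.ofFn_termTokens_natAdd {L : FirstOrder.Language.{0, 0}}
    [∀ k, Encodable (L.Functions k)] (k : ℕ) :
    (List.ofFn fun i : Fin k => Fml.termTokens
      (FirstOrder.Language.Term.var (Fin.natAdd 2 i) : L.Term (Fin (2 + k)))) =
      (List.range k).map fun i => [Nat.pair 0 (2 + i)] := by
  refine List.ext_getElem (by simp) fun i h₁ h₂ => ?_
  simp [Fml.termTokens]

namespace GenericConfiguration

variable {L : FirstOrder.Language.{0, 0}} [L.IsOrdered] [L.Structure ℕ] [L.OrderedStructure ℕ]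
  [∀ k, Encodable (L.Functions k)] [∀ k, Encodable (L.Relations k)]

/-! ### Existence of the formulas expressing negation and provability -/

theorem isPi_of_mem (ξ : GenericConfiguration L) {t : Sent L} (ht : t ∈ ξ.Delta 0) (k : ℕ) :
    ξ.IsPi k t := by
  have : ∀ b, Prenex ξ.Delta b k t := by
    induction k with
    | zero => exact fun b => .zero ht
    | succ k ih => exact fun b => .step (ih _)
  exact this true

theorem primrec_encode_replicate_append {α : Type} [Primcodable α] (c : ℕ) {f : α → ℕ}
    {l : α → List ℕ} (hf : Primrec f) (hl : Primrec l) :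
    Primrec fun x => Encodable.encode (List.replicate (f x) c ++ l x) :=
  Primrec.encode.comp (Primrec.list_append.comp ((Primrec.list_replicate_const c).comp hf) hl)

theorem exists_expressesNeg_zero (ξ : GenericConfiguration L) :
    ∃ N : Fml L 3, ξ.ExpressesNeg 0 N := by
  have h : REPred fun c : ℕ => ∃ φ ∈ ξ.Delta 0, φ.code = c :=
    ξ.delta_re.comp (f := fun c : ℕ => (0, c)) ((Computable.const 0).pair Computable.id)
  have hf : Primrec fun c : ℕ => (c, Encodable.encode (Nat.pair 2 1 :: decodeTokens c)) :=
    Primrec.id.pair (Primrec.encode.comp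
      (Primrec.list_cons.comp (Primrec.const _) primrec_decodeTokens))
  obtain ⟨N, hN, h⟩ := ξ.exists_delta_of_rePred₂ (h.image hf.to_comp)
  refine ⟨N, hN, fun x y => (h x y).trans ?_⟩
  have key : ∀ t ∈ ξ.Delta 0,
      t.prenexNeg.code = Encodable.encode (Nat.pair 2 1 :: decodeTokens t.code) := by
    intro t ht
    rw [(ξ.fullyBounded ht).prenexNeg, Fml.decodeTokens_code]
    rfl
  constructor
  · rintro ⟨_, ⟨t, ht, rfl⟩, h⟩
    rw [Prod.mk.injEq] at h
    exact ⟨t, .zero ht, h.1.symm, (key t ht).trans h.2.symm⟩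
  · rintro ⟨t, ht, rfl, rfl⟩
    exact ⟨_, ⟨t, ht.mem_of_zero, rfl⟩, by rw [key t ht.mem_of_zero]⟩

/-- A `Π₁` sentence arises from a number `k` and a `Δ₀` matrix. On strings, negation turns the `k`
leading universal symbols into existential ones and puts a negation symbol before the matrix. The
pairs of codes thus form a computable image of the r.e. class `Δ₀`. -/
theorem exists_expressesNeg_one (ξ : GenericConfiguration L) :
    ∃ N : Fml L 3, ξ.ExpressesNeg 1 N := by
  have hf : Primrec fun x : ℕ × ℕ =>
      (Encodable.encode (List.replicate x.1 (Nat.pair 2 7) ++ decodeTokens x.2),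
        Encodable.encode (List.replicate x.1 (Nat.pair 2 8) ++
          (Nat.pair 2 1 :: decodeTokens x.2))) :=
    (primrec_encode_replicate_append _ Primrec.fst (primrec_decodeTokens.comp Primrec.snd)).pair
      (primrec_encode_replicate_append _ Primrec.fst (Primrec.list_cons.comp (Primrec.const _)
        (primrec_decodeTokens.comp Primrec.snd)))
  obtain ⟨N, hN, h⟩ := ξ.exists_delta_of_rePred₂ (ξ.delta_re.image hf.to_comp)
  refine ⟨N, hN, fun x y => (h x y).trans ?_⟩
  have key : ∀ k, ∀ φ ∈ ξ.Delta k, (φ.allClosure.code, φ.allClosure.prenexNeg.code) =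
      (Encodable.encode (List.replicate k (Nat.pair 2 7) ++ decodeTokens φ.code),
        Encodable.encode (List.replicate k (Nat.pair 2 8) ++
          (Nat.pair 2 1 :: decodeTokens φ.code))) := by
    intro k φ hφ
    rw [Fml.prenexNeg_allClosure (ξ.fullyBounded hφ), Fml.decodeTokens_code, Fml.code, Fml.code,
      Fml.tokens_allClosure, Fml.tokens_exClosure]
    rfl
  constructor
  · rintro ⟨⟨k, c⟩, hc, h⟩
    obtain ⟨φ, hφ, rfl⟩ : ∃ φ ∈ ξ.Delta k, φ.code = c := hc
    have h := h.trans (key k φ hφ).symm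
    rw [Prod.mk.injEq] at h
    exact ⟨_, (Prenex.of_mem hφ).allClosure, h.1.symm, h.2.symm⟩
  · rintro ⟨t, ht, rfl, rfl⟩
    obtain ⟨k, φ, hφ, rfl⟩ := prenex_true_one_iff.1 ht
    exact ⟨(k, φ.code), ⟨φ, hφ, rfl⟩, key k φ hφ⟩

/-- The code of `Γ(T_m)` is computable from the code `m` of `Γ`, so the systems `β ∪ {Γ(T_m)}` are
r.e. uniformly in `m`, and so is provability from them. -/
theorem exists_expressesSubstPrf (ξ : GenericConfiguration L) {β : Set (Sent L)}
    (hβ : Fml.IsRE β) : ∃ S : Fml L 4, ξ.ExpressesSubstPrf β S := by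
  have hF : Computable fun m : ℕ => Encodable.encode ((decodeTokens m).flatMap
      (Fml.substToken [Fml.termTokens (ξ.numeral m)] 0)) :=
    Computable.encode.comp (Fml.computable_flatMap_substToken
      (Computable.list_cons.comp ξ.numeral_computable (Computable.const []))
        (Computable.const 0) primrec_decodeTokens.to_comp)
  have hq : REPred fun x : ℕ × ℕ => (∃ φ ∈ β, φ.code = x.2) ∨
      x.2 = Encodable.encode ((decodeTokens x.1).flatMap
        (Fml.substToken [Fml.termTokens (ξ.numeral x.1)] 0)) :=
    (hβ.comp Computable.snd).or (.eq Computable.snd (hF.comp Computable.fst))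
  obtain ⟨S, hS, hm, h⟩ := ξ.exists_delta_of_rePred₃ (ξ.g.rePred_prf hq)
  refine ⟨S, hS, hm, fun Γ t p => (h _ t p).trans ?_⟩
  have hΓ : (ξ.selfApply Γ).code = Encodable.encode ((decodeTokens Γ.code).flatMap
      (Fml.substToken [Fml.termTokens (ξ.numeral Γ.code)] 0)) := by
    rw [selfApply, Fml.code, Fml.tokens_subst, Fml.decodeTokens_code]
    simp
  have : {a : Sent L | (∃ φ ∈ β, φ.code = a.code) ∨
      a.code = Encodable.encode ((decodeTokens Γ.code).flatMap
        (Fml.substToken [Fml.termTokens (ξ.numeral Γ.code)] 0))} = β ∪ {ξ.selfApply Γ} := by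
    ext a
    exact or_congr Fml.exists_mem_code_iff (hΓ ▸ Fml.code_injective.eq_iff)
  exact exists_congr fun τ => and_congr_right fun _ => by rw [← this]

theorem exists_expressesPrf (ξ : GenericConfiguration L) {L' : FirstOrder.Language.{0, 0}}
    [∀ k, Encodable (L'.Functions k)] [∀ k, Encodable (L'.Relations k)] {ι : L →ᴸ L'}
    (hι : EffectiveExtension ι) {𝓑 : Set (Sent L')} (h𝓑 : Fml.IsRE 𝓑)
    {D : DeductionMethod L'} (G : ProofNumbering D) : ∃ P : Fml L 3, ξ.ExpressesPrf ι 𝓑 D G P := by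
  obtain ⟨-, f, hf, hfι⟩ := hι
  have hq : REPred fun x : ℕ × ℕ => ∃ φ ∈ 𝓑, φ.code = x.2 := REPred.comp h𝓑 Computable.snd
  have hp : REPred fun x : ℕ × ℕ × ℕ => ∃ τ : Sent L', τ.code = f x.1 ∧
      D.Prf G {a | ∃ φ ∈ 𝓑, φ.code = a.code} τ x.2.1 :=
    (G.rePred_prf hq).comp (f := fun x : ℕ × ℕ × ℕ => (0, f x.1, x.2.1))
      ((Computable.const 0).pair ((hf.comp Computable.fst).pair
        (Computable.fst.comp Computable.snd)))
  obtain ⟨S, hS, hm, h⟩ := ξ.exists_delta_of_rePred₃ hp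
  -- The available formula has one place too many; the proof code `q` occupies both middle places.
  refine ⟨S.rename ![0, 1, 1, 2], ξ.rename_mem _ hS, fun m => ?_, fun Ψ q => ?_⟩
  · have := ξ.rename_mem (![0, 0, 1] : Fin 3 → Fin 2) (hm m)
    rw [Fml.subst_rename] at this
    rw [Fml.rename_subst]
    convert this using 2
    funext i
    fin_cases i
    · exact ((FirstOrder.Language.Term.relabel_relabel _ _ _).trans
        (congrArg (ξ.numeral m).relabel (Subsingleton.elim (α := Fin 0 → Fin 2) _ _))).symm
    all_goals rfl
  · have e : ∀ w : ℕ, (S.rename ![0, 1, 1, 2]).Realize ![Ψ.code, q, w] ↔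
        S.Realize ![Ψ.code, q, q, w] := by
      intro w
      refine (Fml.realize_rename _ _ _).trans (iff_of_eq (congrArg S.Realize (funext fun i => ?_)))
      fin_cases i <;> rfl
    refine (exists_congr e).trans ((h _ q q).trans ?_)
    have : {a : Sent L' | ∃ φ ∈ 𝓑, φ.code = a.code} = 𝓑 :=
      Set.ext fun a => Fml.exists_mem_code_iff
    simp only [this, ← hfι]
    simp only [Fml.code_injective.eq_iff, exists_eq_left]

theorem exists_isSelfCons (ξ : GenericConfiguration L) {k : ℕ} (hk : k = 0 ∨ k = 1)
    {β : Set (Sent L)} (hβ : Fml.IsRE β) : ∃ Φ : Sent L, ξ.IsSelfCons k β Φ := by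
  obtain ⟨N, hN⟩ : ∃ N : Fml L 3, ξ.ExpressesNeg k N := by
    rcases hk with rfl | rfl
    exacts [ξ.exists_expressesNeg_zero, ξ.exists_expressesNeg_one]
  obtain ⟨S, hS⟩ := ξ.exists_expressesSubstPrf hβ
  exact ⟨_, N, S, hN, hS, rfl⟩

/-! ### The reflection schema -/

/-- The instance of the formula `P` for the numeral of `m`. -/
def instance₂ (ξ : GenericConfiguration L) (P : Fml L 3) (m : ℕ) : Fml L 2 :=
  P.subst ![ξ.num 2 m, FirstOrder.Language.Term.var 0, FirstOrder.Language.Term.var 1]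

theorem realize_instance₂ (ξ : GenericConfiguration L) (P : Fml L 3) (m : ℕ) (v : Fin 2 → ℕ) :
    (ξ.instance₂ P m).Realize v ↔ P.Realize ![m, v 0, v 1] := by
  refine (Fml.realize_subst _ _ _).trans (iff_of_eq (congrArg P.Realize (funext fun i => ?_)))
  fin_cases i
  · exact ξ.realize_num 2 m v
  all_goals rfl

theorem group2_isPi (ξ : GenericConfiguration L) {P : Fml L 3}
    (hP : ∀ m, ξ.instance₂ P m ∈ ξ.Delta 2) {a : Sent L} (ha : a ∈ ξ.group2 P) : ξ.IsPi 1 a := by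
  obtain ⟨k, φ, hφ, rfl⟩ := ha
  exact (Prenex.of_mem (ξ.imp_mem (ξ.rename_mem _ (hP _)) (ξ.rename_mem _ hφ))).allClosure

/-- The string of a reflection axiom is computable from the number of variables and the code of the
matrix: form the code of the closure, insert its numeral into `P`, then rename the variables of both
parts into the common block of `2 + k`. -/
theorem group2_isRE (ξ : GenericConfiguration L) (P : Fml L 3) : Fml.IsRE (ξ.group2 P) := by
  have hnum : Computable fun x : ℕ × ℕ => Fml.termTokens (ξ.numeral
      (Encodable.encode (List.replicate x.1 (Nat.pair 2 7) ++ decodeTokens x.2))) :=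
    ξ.numeral_computable.comp (primrec_encode_replicate_append _ Primrec.fst
      (primrec_decodeTokens.comp Primrec.snd)).to_comp
  have hk : Primrec fun x : ℕ × ℕ => 2 + x.1 := Primrec.nat_add.comp (Primrec.const 2) Primrec.fst
  have h₁ : Computable fun x : ℕ × ℕ => P.tokens.flatMap (Fml.substToken
      [Fml.termTokens (ξ.numeral (Encodable.encode (List.replicate x.1 (Nat.pair 2 7) ++
        decodeTokens x.2))), [Nat.pair 0 0], [Nat.pair 0 1] ] 2) :=
    Fml.computable_flatMap_substToken (Computable.list_cons.comp hnum (Computable.const _))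
      (Computable.const 2) (Computable.const P.tokens)
  have h₂ : Computable fun x : ℕ × ℕ => (P.tokens.flatMap (Fml.substToken
      [Fml.termTokens (ξ.numeral (Encodable.encode (List.replicate x.1 (Nat.pair 2 7) ++
        decodeTokens x.2))), [Nat.pair 0 0], [Nat.pair 0 1] ] 2)).flatMap
        (Fml.substToken [ [Nat.pair 0 0], [Nat.pair 0 1] ] (2 + x.1)) :=
    Fml.computable_flatMap_substToken (Computable.const _) hk.to_comp h₁
  have h₃ : Computable fun x : ℕ × ℕ => (decodeTokens x.2).flatMap (Fml.substToken
      ((List.range x.1).map fun i => [Nat.pair 0 (2 + i)]) (2 + x.1)) := by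
    refine Fml.computable_flatMap_substToken (Primrec.to_comp ?_) hk.to_comp
      (primrec_decodeTokens.comp Primrec.snd).to_comp
    refine Primrec.list_map (Primrec.list_range.comp Primrec.fst) ?_
    exact Primrec.list_cons.comp (Primrec₂.natPair.comp (Primrec.const 0)
      (Primrec.nat_add.comp (Primrec.const 2) Primrec.snd)) (Primrec.const [])
  have h₄ := Computable.encode.comp (Computable.list_append.comp
    ((Primrec.list_replicate_const (Nat.pair 2 7)).comp hk).to_comp
    (Computable.list_cons.comp (Computable.const (Nat.pair 2 4))
      (Computable.list_append.comp h₂ h₃)))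
  have key : ∀ (k : ℕ) (φ : Fml L k), (ξ.reflectionAxiom P φ).code =
      Encodable.encode (List.replicate (2 + k) (Nat.pair 2 7) ++ Nat.pair 2 4 ::
        ((P.tokens.flatMap (Fml.substToken [Fml.termTokens (ξ.numeral (Encodable.encode
          (List.replicate k (Nat.pair 2 7) ++ decodeTokens φ.code))), [Nat.pair 0 0],
            [Nat.pair 0 1] ] 2)).flatMap
              (Fml.substToken [ [Nat.pair 0 0], [Nat.pair 0 1] ] (2 + k)) ++
        (decodeTokens φ.code).flatMap (Fml.substToken
          ((List.range k).map fun i => [Nat.pair 0 (2 + i)]) (2 + k)))) := by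
    intro k φ
    have h₅ : (List.ofFn fun i => Fml.termTokens ((![ξ.num 2 φ.allClosure.code,
        FirstOrder.Language.Term.var 0, FirstOrder.Language.Term.var 1] :
          Fin 3 → L.Term (Fin 2)) i)) =
        [Fml.termTokens (ξ.numeral (Encodable.encode (List.replicate k (Nat.pair 2 7) ++
          decodeTokens φ.code))), [Nat.pair 0 0], [Nat.pair 0 1] ] := by
      rw [Fml.decodeTokens_code, ← Fml.tokens_allClosure,
        ← Fml.termTokens_relabel_elim0 (n := 2)]
      rfl
    have h₆ : (List.ofFn fun i : Fin 2 => Fml.termTokens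
        (FirstOrder.Language.Term.var (Fin.castAdd k i) : L.Term (Fin (2 + k)))) =
        [ [Nat.pair 0 0], [Nat.pair 0 1] ] := rfl
    rw [reflectionAxiom, Fml.code, Fml.tokens_allClosure, Fml.tokens, Fml.rename, Fml.rename,
      Fml.tokens_subst, Fml.tokens_subst, Fml.tokens_subst, Fml.ofFn_termTokens_natAdd, h₅, h₆,
      Fml.decodeTokens_code]
  refine (ξ.delta_re.image h₄).of_eq fun c => ?_
  constructor
  · rintro ⟨⟨k, c⟩, hc, rfl⟩
    obtain ⟨φ, hφ, rfl⟩ : ∃ φ ∈ ξ.Delta k, φ.code = c := hc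
    exact ⟨_, ⟨k, φ, hφ, rfl⟩, key k φ⟩
  · rintro ⟨_, ⟨k, φ, hφ, rfl⟩, rfl⟩
    exact ⟨(k, φ.code), ⟨φ, hφ, rfl⟩, key k φ⟩

end GenericConfiguration

namespace GenericConfiguration

variable {L : FirstOrder.Language.{0, 0}} [L.IsOrdered] [L.Structure ℕ] [L.OrderedStructure ℕ]
  [∀ k, Encodable (L.Functions k)] [∀ k, Encodable (L.Relations k)]

/-! ### The self-consistency sentence -/

/-- The instance of the formula `S` for the numeral of `m`. -/
def instance₃ (ξ : GenericConfiguration L) (S : Fml L 4) (m : ℕ) : Fml L 3 :=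
  S.subst ![ξ.num 3 m, FirstOrder.Language.Term.var 0, FirstOrder.Language.Term.var 1,
    FirstOrder.Language.Term.var 2]

theorem realize_instance₃ (ξ : GenericConfiguration L) (S : Fml L 4) (m : ℕ) (v : Fin 3 → ℕ) :
    (ξ.instance₃ S m).Realize v ↔ S.Realize ![m, v 0, v 1, v 2] := by
  refine (Fml.realize_subst _ _ _).trans (iff_of_eq (congrArg S.Realize (funext fun i => ?_)))
  fin_cases i
  · exact ξ.realize_num 3 m v
  all_goals rfl

/-- The matrix of the self-consistency sentence. -/
def selfConsMatrix (ξ : GenericConfiguration L) (N : Fml L 3) (S : Fml L 4) (m : ℕ) : Fml L 7 :=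
  .neg (.and (N.rename ![0, 1, 4]) (.and ((ξ.instance₃ S m).rename ![0, 2, 5])
    ((ξ.instance₃ S m).rename ![1, 3, 6])))

/-- This exhibits the sentence as the closure of a matrix built from numeral instances of `S`, which
are `Δ₀`. Once the numeral replaces variable `0`, the seven quantified variables move down by one
place. -/
theorem selfApply_selfConsFml (ξ : GenericConfiguration L) (N : Fml L 3) (S : Fml L 4) :
    ξ.selfApply (selfConsFml N S) =
      (ξ.selfConsMatrix N S (selfConsFml N S).code).allClosure := by
  generalize hm : (selfConsFml N S).code = m
  rw [selfApply, hm]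
  -- The substitution of the numeral as it arrives at the matrix, below seven quantifiers.
  let σ : Fin 8 → L.Term (Fin 7) := Fml.liftSubst <| Fml.liftSubst <| Fml.liftSubst <|
    Fml.liftSubst <| Fml.liftSubst <| Fml.liftSubst <| Fml.liftSubst ![ξ.numeral m]
  have h₀ : ∀ f : Fin 3 → Fin 7, (ξ.num 3 m).relabel f = σ 0 := by
    intro f
    have h : (ξ.numeral m).relabel (Fin.elim0 : Fin 0 → Fin 7) = σ 0 := by
      change _ = (((((((ξ.numeral m).relabel Fin.castSucc).relabel Fin.castSucc).relabel
        Fin.castSucc).relabel Fin.castSucc).relabel Fin.castSucc).relabel Fin.castSucc).relabel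
        Fin.castSucc
      simp only [FirstOrder.Language.Term.relabel_relabel]
      exact congrArg (ξ.numeral m).relabel (Subsingleton.elim (α := Fin 0 → Fin 7) _ _)
    refine Eq.trans ?_ h
    exact (FirstOrder.Language.Term.relabel_relabel _ _ _).trans
      (congrArg (ξ.numeral m).relabel (Subsingleton.elim (α := Fin 0 → Fin 7) _ _))
  have hN : (N.rename ![(1 : Fin 8), 2, 5]).subst σ = N.rename ![0, 1, 4] := by
    rw [Fml.rename_subst, Fml.rename]
    congr 1
    funext i
    fin_cases i <;> rfl
  have hS₁ : (S.rename ![(0 : Fin 8), 1, 3, 6]).subst σ =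
      (ξ.instance₃ S m).rename ![0, 2, 5] := by
    rw [Fml.rename_subst, instance₃, Fml.subst_rename]
    congr 1
    funext i
    fin_cases i
    · exact (h₀ _).symm
    all_goals rfl
  have hS₂ : (S.rename ![(0 : Fin 8), 2, 4, 7]).subst σ =
      (ξ.instance₃ S m).rename ![1, 3, 6] := by
    rw [Fml.rename_subst, instance₃, Fml.subst_rename]
    congr 1
    funext i
    fin_cases i
    · exact (h₀ _).symm
    all_goals rfl
  rw [selfConsMatrix, ← hN, ← hS₁, ← hS₂]
  rfl

theorem selfConsMatrix_mem (ξ : GenericConfiguration L) {N : Fml L 3} {S : Fml L 4} {m : ℕ}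
    (hN : N ∈ ξ.Delta 3) (hS : ξ.instance₃ S m ∈ ξ.Delta 3) :
    ξ.selfConsMatrix N S m ∈ ξ.Delta 7 :=
  ξ.neg_mem (ξ.and_mem (ξ.rename_mem _ hN) (ξ.and_mem (ξ.rename_mem _ hS) (ξ.rename_mem _ hS)))

theorem realize_selfConsMatrix (ξ : GenericConfiguration L) (N : Fml L 3) (S : Fml L 4) (m : ℕ)
    (u : Fin 7 → ℕ) : (ξ.selfConsMatrix N S m).Realize u ↔ ¬ (N.Realize ![u 0, u 1, u 4] ∧
      S.Realize ![m, u 0, u 2, u 5] ∧ S.Realize ![m, u 1, u 3, u 6]) := by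
  refine not_congr (and_congr ?_ (and_congr ?_ ?_))
  · refine (Fml.realize_rename _ _ _).trans (iff_of_eq (congrArg N.Realize (funext fun i => ?_)))
    fin_cases i <;> rfl
  · exact (Fml.realize_rename _ _ _).trans (ξ.realize_instance₃ S m _)
  · exact (Fml.realize_rename _ _ _).trans (ξ.realize_instance₃ S m _)

namespace IsSelfCons

variable {ξ : GenericConfiguration L} {k : ℕ} {β : Set (Sent L)} {Φ : Sent L}

theorem isPi (h : ξ.IsSelfCons k β Φ) : ξ.IsPi 1 Φ := by
  obtain ⟨N, S, hN, hS, rfl⟩ := h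
  rw [selfApply_selfConsFml]
  exact (Prenex.of_mem (ξ.selfConsMatrix_mem hN.1 (hS.2.1 _))).allClosure

/-- The sentence fails in a segment of the natural numbers only if this segment contains a pair of
proofs of a sentence and its negation. -/
theorem exists_proofs_of_not_good (h : ξ.IsSelfCons k β Φ) {x : EReal} (hx : ¬ Fml.Good x Φ) :
    ∃ (t : Sent L) (p q : ℕ), ξ.IsPi k t ∧ ξ.d.Prf ξ.g (β ∪ {Φ}) t p ∧
      ξ.d.Prf ξ.g (β ∪ {Φ}) t.prenexNeg q ∧ t.code ∈ Fml.numbersBelow x ∧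
      q ∈ Fml.numbersBelow x ∧ p ∈ Fml.numbersBelow x := by
  obtain ⟨N, S, hN, hS, rfl⟩ := h
  have hM := ξ.selfConsMatrix_mem hN.1 (hS.2.1 (selfConsFml N S).code)
  rw [Fml.Good] at hx
  generalize hΦ : ξ.selfApply (selfConsFml N S) = Φ at hx ⊢
  rw [← hΦ, selfApply_selfConsFml, Fml.realizeOn_allClosure] at hx
  push Not at hx
  obtain ⟨u, hu, hx⟩ := hx
  rw [(ξ.fullyBounded hM).realizeOn_iff, realize_selfConsMatrix, not_not] at hx
  obtain ⟨h₁, h₂, h₃⟩ := hx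
  obtain ⟨t, ht, ht₁, ht₂⟩ := (hN.2 _ _).1 ⟨_, h₁⟩
  obtain ⟨τ, hτ, hp⟩ := (hS.2.2 _ _ _).1 ⟨_, h₂⟩
  obtain ⟨τ', hτ', hq⟩ := (hS.2.2 _ _ _).1 ⟨_, h₃⟩
  obtain rfl := Fml.code_injective (hτ.trans ht₁.symm)
  obtain rfl := Fml.code_injective (hτ'.trans ht₂.symm)
  rw [hΦ] at hp hq
  -- In the order `x y p q u v w`, places 0, 2 and 3 hold the code of the sentence and the two
  -- proofs.
  exact ⟨τ, _, _, ht, hp, hq, ht₁ ▸ hu 0, hu 3, hu 2⟩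

theorem levelConsistent (h : ξ.IsSelfCons k β Φ) (hΦ : Fml.TrueInNat Φ) :
    ξ.LevelConsistent k (β ∪ {Φ}) := by
  rintro ⟨t, ht, ⟨π, hπ⟩, π', hπ'⟩
  have hisPi := h.isPi
  obtain ⟨N, S, hN, hS, hΦ'⟩ := h
  obtain ⟨u, hu⟩ := (hN.2 _ _).2 ⟨t, ht, rfl, rfl⟩
  obtain ⟨v, hv⟩ := (hS.2.2 (selfConsFml N S) t.code (ξ.g.num π)).2
    ⟨t, rfl, π, hΦ' ▸ hπ, rfl⟩
  obtain ⟨w, hw⟩ := (hS.2.2 (selfConsFml N S) t.prenexNeg.code (ξ.g.num π')).2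
    ⟨_, rfl, π', hΦ' ▸ hπ', rfl⟩
  rw [Fml.TrueInNat, hΦ', selfApply_selfConsFml, Fml.realize_allClosure] at hΦ
  exact (ξ.realize_selfConsMatrix _ _ _ _).1
    (hΦ ![t.code, t.prenexNeg.code, ξ.g.num π, ξ.g.num π', u, v, w]) ⟨hu, hv, hw⟩

end IsSelfCons

/-! ### Restricted truth -/

/-- Since `Real.logb 2 0 = 0`, the special clause for `v = 0` is absorbed as soon as `x` is
positive. -/
theorem mem_numbersBelow_coe {v : ℕ} {x : ℝ} (hx : 0 < x) :
    v ∈ Fml.numbersBelow x ↔ Real.logb 2 v < x := by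
  rw [Fml.numbersBelow, Set.mem_ofPred_eq, EReal.coe_lt_coe_iff]
  refine ⟨?_, Or.inr⟩
  rintro (rfl | h)
  · simpa using hx
  · exact h

theorem eq_zero_of_mem_numbersBelow_zero {v : ℕ} (h : v ∈ Fml.numbersBelow 0) : v = 0 := by
  rcases h with h | h
  · exact h
  · by_contra hv
    rw [← EReal.coe_zero, EReal.coe_lt_coe_iff] at h
    exact absurd h (not_lt.2 (Real.logb_nonneg one_lt_two
      (Nat.one_le_cast.2 (Nat.one_le_iff_ne_zero.2 hv))))

theorem numbersBelow_mono {x y : EReal} (h : x ≤ y) : Fml.numbersBelow x ⊆ Fml.numbersBelow y :=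
  fun _ hv => hv.imp_right fun hv => hv.trans_le h

theorem IsPi.good_iff {ξ : GenericConfiguration L} {t : Sent L} (h : ξ.IsPi 1 t) :
    ∃ (k : ℕ) (φ : Fml L k), ∀ x, Fml.Good x t ↔
      ∀ u : Fin k → ℕ, (∀ i, u i ∈ Fml.numbersBelow x) → φ.Realize u := by
  obtain ⟨k, φ, hφ, rfl⟩ := prenex_true_one_iff.1 h
  refine ⟨k, φ, fun x => ?_⟩
  rw [Fml.Good, Fml.realizeOn_allClosure]
  simp only [(ξ.fullyBounded hφ).realizeOn_iff]

theorem IsPi.good_mono {ξ : GenericConfiguration L} {t : Sent L} (h : ξ.IsPi 1 t) {x y : EReal}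
    (hxy : x ≤ y) (hy : Fml.Good y t) : Fml.Good x t := by
  obtain ⟨k, φ, hφ⟩ := h.good_iff
  rw [hφ] at hy ⊢
  exact fun u hu => hy u fun i => numbersBelow_mono hxy (hu i)

theorem IsPi.good_of_true {ξ : GenericConfiguration L} {t : Sent L} (h : ξ.IsPi 1 t)
    (ht : Fml.TrueInNat t) (x : EReal) : Fml.Good x t := by
  obtain ⟨k, φ, hφ, rfl⟩ := prenex_true_one_iff.1 h
  rw [Fml.TrueInNat, Fml.realize_allClosure] at ht
  rw [Fml.Good, Fml.realizeOn_allClosure]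
  exact fun u _ => ((ξ.fullyBounded hφ).realizeOn_iff _ _).2 (ht u)

theorem IsPi.exists_not_good {ξ : GenericConfiguration L} {t : Sent L} (h : ξ.IsPi 1 t)
    (ht : ¬ Fml.TrueInNat t) : ∃ J : ℕ, ¬ Fml.Good ((J : ℝ) : EReal) t := by
  obtain ⟨k, φ, hφ, rfl⟩ := prenex_true_one_iff.1 h
  rw [Fml.TrueInNat, Fml.realize_allClosure] at ht
  push Not at ht
  obtain ⟨u, hu⟩ := ht
  obtain ⟨J, hJ⟩ : ∃ J : ℕ, ∀ i, Real.logb 2 (u i) < J := by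
    obtain ⟨J, hJ⟩ := exists_nat_gt (∑ i, |Real.logb 2 (u i)|)
    exact ⟨J, fun i => (le_abs_self _).trans_lt ((Finset.single_le_sum
      (f := fun i => |Real.logb 2 (u i : ℝ)|) (fun _ _ => abs_nonneg _)
      (Finset.mem_univ i)).trans_lt hJ)⟩
  refine ⟨J, fun h => hu ?_⟩
  rw [Fml.Good, Fml.realizeOn_allClosure] at h
  exact ((ξ.fullyBounded hφ).realizeOn_iff _ _).1
    (h u fun i => Or.inr (EReal.coe_lt_coe_iff.2 (hJ i)))

theorem good_iff_of_mem {ξ : GenericConfiguration L} {t : Sent L} (h : t ∈ ξ.Delta 0)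
    (x : EReal) : Fml.Good x t ↔ Fml.TrueInNat t :=
  (ξ.fullyBounded h).realizeOn_iff _ _

/-- If a set of `Π₁` sentences consists of true sentences and a false one that holds in the
segment `{0}`, the least segment where it fails determines `♯`. -/
theorem exists_sharp_eq {ξ : GenericConfiguration L} {θ : Set (Sent L)} {Φ : Sent L}
    (hθ : ∀ a ∈ θ, ξ.IsPi 1 a) (htrue : ∀ a ∈ θ, Fml.TrueInNat a) (hΦ : ξ.IsPi 1 Φ)
    (hfalse : ¬ Fml.TrueInNat Φ) (hzero : Fml.Good 0 Φ) :
    ∃ J : ℕ, Fml.sharp (θ ∪ {Φ}) = ((J : ℝ) : EReal) ∧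
      ¬ Fml.Good (((J + 1 : ℕ) : ℝ) : EReal) Φ := by
  classical
  have hex := hΦ.exists_not_good hfalse
  -- The least failing segment is not the one for `0`, by `hzero`. True members of `θ` hold on every
  -- segment, so `Φ` alone fixes the value of `♯`.
  obtain ⟨J, hJ⟩ : ∃ J, Nat.find hex = J + 1 := by
    refine Nat.exists_eq_succ_of_ne_zero fun h => Nat.find_spec hex ?_
    rw [h]
    simpa using hzero
  have hJ' : ¬ Fml.Good (((J + 1 : ℕ) : ℝ) : EReal) Φ := hJ ▸ Nat.find_spec hex
  refine ⟨J, le_antisymm (sSup_le ?_) (le_sSup ⟨J, rfl, ?_⟩), hJ'⟩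
  · rintro _ ⟨K, rfl, hK⟩
    refine EReal.coe_le_coe_iff.2 (Nat.cast_le.2 ?_)
    by_contra h
    exact hJ' (hΦ.good_mono (EReal.coe_le_coe_iff.2 (Nat.cast_le.2 (not_le.1 h)))
      (hK Φ (Or.inr rfl)))
  · rintro a (ha | rfl)
    · exact (hθ a ha).good_of_true (htrue a ha) _
    · exact not_not.1 (Nat.find_min hex (by omega))

/-! ### Consistency -/

/-- Stability in the form in which it is used: no R-View has a short proof of a `Π_k` sentence and
a slightly shorter one of its negation. -/
def ExcludesShortInconsistency (ξ : GenericConfiguration L) (k : ℕ) : Prop :=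
  ∀ θ, ξ.IsRView θ → ∀ J : ℕ, Fml.sharp θ = ((J : ℝ) : EReal) → ∀ t p q, ξ.IsPi k t →
    ξ.ShortProof θ t p → ξ.ShortProof θ t.prenexNeg q → ¬ Real.logb 2 (q : ℝ) < J + 1

theorem EAStable.excludesShortInconsistency {ξ : GenericConfiguration L} (h : ξ.EAStable) :
    ξ.ExcludesShortInconsistency 1 := by
  intro θ hθ J hJ t p q ht hp hq hlog
  have hA := h.2 θ hθ t p ht hp
  obtain ⟨k, φ, hφ, rfl⟩ := prenex_true_one_iff.1 ht
  rw [Fml.prenexNeg_allClosure (ξ.fullyBounded hφ)] at hq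
  have hE := h.1 θ hθ _ q (Prenex.of_mem (ξ.neg_mem hφ)).exClosure hq
  rw [Fml.Good, Fml.realizeOn_allClosure, hJ] at hA
  rw [Fml.Good, Fml.realizeOn_exClosure] at hE
  obtain ⟨u, hu, hφu⟩ := hE
  refine hφu (((ξ.fullyBounded hφ).realizeOn_iff _ _).2 (((ξ.fullyBounded hφ).realizeOn_iff _ _).1
    (hA u fun i => numbersBelow_mono ?_ (hu i))))
  -- As `J` is an integer, the floor is at most `J`; hence the range `⌊log q⌋ / 2 - 1` of the
  -- E-stable witnesses lies within the range `J / 2` where `φ` holds.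
  have h₁ : ⌊Real.logb 2 (q : ℝ)⌋ < (J : ℤ) + 1 := Int.floor_lt.2 (by exact_mod_cast hlog)
  have h₂ : (⌊Real.logb 2 (q : ℝ)⌋ : ℝ) ≤ J := by exact_mod_cast Int.lt_add_one_iff.1 h₁
  have h₃ : ((J : ℝ) : EReal) / 2 = ((J / 2 : ℝ) : EReal) := by
    rw [EReal.coe_div]
    rfl
  rw [h₃, EReal.coe_le_coe_iff]
  linarith

/-- For a `Δ₀` sentence, `Good` at any argument is plain truth, so each of the three notions makes
short proofs of `Δ₀` sentences sound. A sentence and its negation are not both true. -/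
theorem excludesShortInconsistency_zero {ξ : GenericConfiguration L}
    (h : ξ.AStable ∨ ξ.EStable ∨ ξ.ZeroStable) : ξ.ExcludesShortInconsistency 0 := by
  intro θ hθ J _ t p q ht hp hq _
  have ht := ht.mem_of_zero
  rw [(ξ.fullyBounded ht).prenexNeg] at hq
  have hn := ξ.neg_mem ht
  suffices h : ∀ s ∈ ξ.Delta 0, ∀ r, ξ.ShortProof θ s r → Fml.TrueInNat s from
    h _ hn q hq (h t ht p hp)
  intro s hs r hr
  rcases h with h | h | h
  · exact (good_iff_of_mem hs _).1 (h θ hθ s r (Prenex.of_mem hs) hr)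
  · exact (good_iff_of_mem hs _).1 (h θ hθ s r (Prenex.of_mem hs) hr)
  · exact h θ hθ s r hs hr

theorem proves_of_mem (ξ : GenericConfiguration L) {α : Set (Sent L)} (hα : ξ.B ⊆ α) {t : Sent L}
    (ht : t ∈ α) : ξ.d.Proves α t :=
  ξ.d_complete α hα t fun _ _ _ h => h t ht

/-- A contradiction at any complexity spreads to all sentences through `d_indirect`, since `t ∧ ¬ t
→ Z` is valid, and so reaches level `k`. -/
theorem LevelConsistent.consistent {ξ : GenericConfiguration L} {k : ℕ} {α : Set (Sent L)}
    (h : ξ.LevelConsistent k α) (hα : ξ.B ⊆ α) : ξ.d.Consistent α := by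
  rintro ⟨t, ht, hn⟩
  have hall : ∀ Z, ξ.d.Proves α Z := fun Z => ξ.d_indirect α hα t (.neg t) Z ht hn
    (ξ.d_complete α hα _ fun M _ _ _ h => absurd h.1 h.2)
  -- Some sentence of level `k` has to exist; `T_0 = T_0` is one.
  exact h ⟨_, ξ.isPi_of_mem (ξ.numeral_eq_numeral_mem 0 0) k, hall _, hall _⟩

/-- The minimal counterexample to `Φ` is an inconsistency whose proofs are short relative to `♯(θ ∪
{Φ})`, exactly the situation that stability excludes. -/
theorem IsSelfCons.trueInNat {ξ : GenericConfiguration L} {k : ℕ}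
    (hξ : ξ.ExcludesShortInconsistency k) {θ : Set (Sent L)} (hθ : ξ.IsRView θ)
    (htrue : ∀ a ∈ θ, Fml.TrueInNat a) {Φ : Sent L} (hΦ : ξ.IsSelfCons k (θ ∪ ξ.B) Φ) :
    Fml.TrueInNat Φ := by
  by_contra hfalse
  have hzero : Fml.Good 0 Φ := by
    by_contra h
    obtain ⟨t, p, q, -, -, -, ht, -⟩ := hΦ.exists_proofs_of_not_good h
    exact t.code_ne_zero (eq_zero_of_mem_numbersBelow_zero ht)
  obtain ⟨J, hJ, hgood⟩ := exists_sharp_eq hθ.2 htrue hΦ.isPi hfalse hzero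
  obtain ⟨t, p, q, ht, hp, hq, -, hq', hp'⟩ := hΦ.exists_proofs_of_not_good hgood
  have hJ₀ : (0 : ℝ) < (J + 1 : ℕ) := Nat.cast_pos.2 J.succ_pos
  rw [mem_numbersBelow_coe hJ₀, Nat.cast_succ] at hp' hq'
  -- Regrouped in this way, `Φ` belongs to the R-View and is no longer an addition to the base
  -- system.
  rw [Set.union_right_comm] at hp hq
  have hle : ∀ r : ℕ, Real.logb 2 (r : ℝ) < (J : ℝ) + 1 →
      ((Real.logb 2 (r : ℝ) : ℝ) : EReal) ≤ Fml.sharp (θ ∪ {Φ}) + 1 := by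
    intro r hr
    rw [hJ]
    exact_mod_cast hr.le
  refine hξ (θ ∪ {Φ}) ⟨hθ.1.union (Fml.isRE_singleton Φ), ?_⟩ J hJ t p q ht ⟨hp, hle p hp'⟩
    ⟨hq, hle q hq'⟩ hq'
  rintro a (ha | rfl)
  exacts [hθ.2 a ha, hΦ.isPi]

/-! ### Reflection -/

section Reflection

variable {ξ : GenericConfiguration L} {L' : FirstOrder.Language.{0, 0}}
  [∀ k, Encodable (L'.Functions k)] [∀ k, Encodable (L'.Relations k)] {ι : L →ᴸ L'}
  {𝓑 : Set (Sent L')} {D : DeductionMethod L'} {G : ProofNumbering D} {P : Fml L 3}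

theorem ExpressesPrf.trueInNat (hP : ξ.ExpressesPrf ι 𝓑 D G P)
    (htrue : ∀ Ψ : Sent L, ξ.IsPi 1 Ψ → D.Proves 𝓑 (Ψ.onLang ι) → Fml.TrueInNat Ψ) {a : Sent L}
    (ha : a ∈ ξ.group2 P) : Fml.TrueInNat a := by
  obtain ⟨k, φ, hφ, rfl⟩ := ha
  refine (Fml.realize_allClosure _ _).2 fun u h => ?_
  have h₁ := (ξ.realize_instance₂ P _ _).1 ((Fml.realize_rename _ _ _).1 h)
  obtain ⟨π, hπ, -⟩ := (hP.2.2 _ _).1 ⟨_, h₁⟩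
  have h₂ := htrue _ (Prenex.of_mem hφ).allClosure ⟨π, hπ⟩
  exact (Fml.realize_rename _ _ _).2 ((Fml.realize_allClosure _ _).1 h₂ _)

theorem ExpressesPrf.proves (hP : ξ.ExpressesPrf ι 𝓑 D G P) {α : Set (Sent L)} (hB : ξ.B ⊆ α)
    (hα : ξ.group2 P ⊆ α) {Ψ : Sent L} (hΨ : ξ.IsPi 1 Ψ) (h : D.Proves 𝓑 (Ψ.onLang ι)) :
    ξ.d.Proves α Ψ := by
  obtain ⟨k, φ, hφ, rfl⟩ := prenex_true_one_iff.1 hΨ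
  obtain ⟨π, hπ⟩ := h
  obtain ⟨w, hw⟩ := (hP.2.2 _ _).2 ⟨π, hπ, rfl⟩
  have hX : ξ.d.Proves α (ξ.instance₂ P φ.allClosure.code).exClosure := by
    refine (ξ.sigma_complete _ (Prenex.of_mem (hP.2.1 _)).exClosure ?_).mono hB
    refine (Fml.realizeOn_exClosure _ _ _).2 ⟨![G.num π, w], fun _ => trivial, ?_⟩
    exact (ξ.realize_instance₂ P _ _).2 hw
  -- `sigma_complete` gives provability of the `Σ₁` sentence, not that it is a logical consequence
  -- of `α`. So `Ψ` is obtained by `d_indirect`, and `d_complete` supplies only the valid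
  -- implication.
  refine ξ.d_indirect α hB _ _ _ hX (ξ.proves_of_mem hB (hα ⟨k, φ, hφ, rfl⟩))
    (ξ.d_complete α hB _ fun M _ _ _ hXY => ?_)
  obtain ⟨u, -, hu⟩ := (Fml.realizeOn_exClosure _ _ _).1 hXY.1
  refine (Fml.realize_allClosure _ _).2 fun v => ?_
  have h₁ := (Fml.realize_allClosure _ _).1 hXY.2 (Fin.append u v) ((Fml.realize_rename _ _ _).2 ?_)
  · have h₂ := (Fml.realize_rename _ _ _).1 h₁
    simpa using h₂
  · simp only [Fin.append_left]
    exact hu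

theorem hasReflectiveSystems {k : ℕ} (hk : k = 0 ∨ k = 1) (hξ : ξ.ExcludesShortInconsistency k)
    (hι : EffectiveExtension ι) (h𝓑 : Fml.IsRE 𝓑)
    (htrue : ∀ Ψ : Sent L, ξ.IsPi 1 Ψ → D.Proves 𝓑 (Ψ.onLang ι) → Fml.TrueInNat Ψ) :
    ξ.HasReflectiveSystems k ι 𝓑 D G := by
  refine ⟨ξ.exists_expressesPrf hι h𝓑 G, fun P hP => ?_⟩
  have hre := (ξ.group2_isRE P).union ξ.B_re
  refine ⟨ξ.exists_isSelfCons hk hre, fun Φ hΦ => ?_⟩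
  have hB : ξ.B ⊆ ξ.group2 P ∪ ξ.B ∪ {Φ} :=
    Set.subset_union_right.trans Set.subset_union_left
  have hcons := hΦ.levelConsistent (hΦ.trueInNat hξ
    ⟨ξ.group2_isRE P, fun a ha => ξ.group2_isPi hP.2.1 ha⟩ fun a ha => hP.trueInNat htrue ha)
  exact ⟨hre.union (Fml.isRE_singleton Φ), hΦ.isPi,
    ⟨⟨_, Φ, Set.subset_union_right, rfl, hΦ, ξ.proves_of_mem hB (Or.inr rfl)⟩, hcons,
      hcons.consistent hB⟩,
    fun Ψ hΨ h => hP.proves hB (Set.subset_union_left.trans Set.subset_union_left) hΨ h⟩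

end Reflection

end GenericConfiguration

theorem mainTheorem5 {L : FirstOrder.Language.{0, 0}} [L.IsOrdered] [L.Structure ℕ]
    [L.OrderedStructure ℕ]
    [∀ k, Encodable (L.Functions k)] [∀ k, Encodable (L.Relations k)]
    (ξ : GenericConfiguration L)
    {L' : FirstOrder.Language.{0, 0}}
    [∀ k, Encodable (L'.Functions k)] [∀ k, Encodable (L'.Relations k)]
    (ι : L →ᴸ L') (hι : EffectiveExtension ι)
    (𝓑 : Set (Sent L')) (h𝓑 : Fml.IsRE 𝓑)
    (D : DeductionMethod L') (G : ProofNumbering D)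
    (htrue : ∀ Ψ : Sent L, ξ.IsPi 1 Ψ → D.Proves 𝓑 (Ψ.onLang ι) → Fml.TrueInNat Ψ) :
    (ξ.EAStable → ξ.HasReflectiveSystems 1 ι 𝓑 D G) ∧
      (ξ.AStable ∨ ξ.EStable ∨ ξ.ZeroStable → ξ.HasReflectiveSystems 0 ι 𝓑 D G) :=
  ⟨fun h => GenericConfiguration.hasReflectiveSystems (Or.inr rfl)
    (GenericConfiguration.EAStable.excludesShortInconsistency h) hι h𝓑 htrue,
  fun h => GenericConfiguration.hasReflectiveSystems (Or.inl rfl)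
    (GenericConfiguration.excludesShortInconsistency_zero h) hι h𝓑 htrue⟩
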